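/- \textbf{Setting (gapless real-power model).} Let $H$ be a self-adjoint operator on a finite-dimensional complex Hilbert space and $U^t=e^{-2\pi i t H}$ for $t\ge 0$. Let $S\ge 1$, $\omega<\beta$, and let $|\psi\rangle=\sum_{s=1}^S c_s|\psi_s\rangle+r$ be a unit vector, where the $|\psi_s\rangle$ are orthonormal with $H|\psi_s\rangle=\lambda_s|\psi_s\rangle$, $\lambda_s\in[0,0.9]$, $|c_s|^2\ge\beta$, and the residual $r$ is orthogonal to all $|\psi_s\rangle$ with $\|r\|^2\le\omega$. No gap between the $\lambda_s$ is assumed. Let $\Lambda=\{\lambda_1,\dots,\lambda_S\}$ and $B(T,r)=\bigcup_{t\in T}[t-r,t+r]$. A circuit that uses the controlled operator $U^t$ has runtime $t$. \textbf{Parameters.} $\tau=\frac1\pi\log\frac{12}{\beta-\omega}$, $\eta=\frac1{8S(2S-1)}$, $K=\lceil 3\eta^{-1}\tau\rceil$, precision $0<\epsilon<\eta$, failure probability $0<\rho<1$, tolerance $\alpha$ with $a(\beta-\omega)\le\alpha<\frac{\beta-\omega}3$ for a constant $a>0$, and $$N_{\rm HR}=2\left\lceil\tfrac4{\alpha^2}\left(\log\tfrac4\rho+\log\left(\lceil\log_2\tfrac\eta\epsilon\rceil+1\right)+\log(K+1)\right)\right\rceil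 .$$ \textbf{Algorithm.} Start with $M=1$ and $E=[0,0.9]$. While $\eta/M>\epsilon$ (for the current $M$), do the following pass. (i) In every pass but the first, choose $m\in[2,4]$, by any rule depending on the current configuration, such that, with $G=B(E,\frac{\eta}{2M})$, one has $(G+\frac q{Mm})\cap G=\varnothing$ for all $q\in\mathbb Z\setminus\{0\}$, whenever such an $m$ exists (otherwise $m\in[2,4]$ is arbitrary); replace $M$ by $Mm$. (ii) For each $0\le k\le K$ run the Hadamard test for $U^{Mk}$ with input $|\psi\rangle$, $N_{\rm HR}/2$ times for the real part and $N_{\rm HR}/2$ times for the imaginary part, all independently; let $y(k)$ be the averaged estimate of $\langle\psi|U^{Mk}|\psi\rangle$ and $y(-k)=\overline{y(k)}$. (iii) With $\hat\phi(k)=e^{-\pi\tau k^2/K^2}$, let $X=\{x\in\mathbb R:|\sum_{|k|\le K}y(k)\hat\phi(k)e^{2\pi i kx}|>\frac{6\beta+5\omega}{11}\sum_{k\in\mathbb Z}\hat\phi(k)\}$, and let $Y$ be the closure of $X$ with all gaps of length less than $\tau/K$ filled in. (iv) Replace $E$ by the union of those connected components of $\frac1M Y$ that meet $E$. The output is the final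 $E$. Let $T_{\max}$ be the largest and $T_{\rm total}$ the sum of the runtimes of all executed circuits. \textbf{Claim.} There are an absolute constant $C_1$, an absolute exponent $p$, and a constant $C_2$ depending only on $a$, such that for all such inputs and parameters: (1) the loop always ends, after at most $\lceil\log_2(\eta/\epsilon)\rceil+1$ passes; (2) with probability at least $1-\rho$, the output satisfies $\Lambda\subset E\subset B(\Lambda,\epsilon)$; (3) always $T_{\max}\le C_1\left(1+\log\frac1{\beta-\omega}\right)\epsilon^{-1}$, and $T_{\max}\le C_1\log\left(\frac1{\beta-\omega}\right)\epsilon^{-1}$ if $\beta-\omega\le\frac12$; that is, $T_{\max}=O(\log(\frac{1}{\beta-\omega})\,\epsilon^{-1})$; (4) always $$T_{\rm total}\le C_2\,(\beta-\omega)^{-2}S^2\epsilon^{-1}\left(1+\log S+\log\tfrac1{\beta-\omega}+\log\tfrac1\epsilon+\log\tfrac1\rho\right)^p ,$$ that is, $T_{\rm total}=\tilde O((\beta-\omega)^{-2}S^2\epsilon^{-1})$. In particular, for fixed $S,\beta,\omega,\rho,a$ one has $T_{\rm total}=\tilde O(\epsilon^{-1})$, the Heisenberg-limited scaling. -/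

import Mathlib

open scoped ENNReal BigOperators

namespace RMPE

noncomputable section

/-! ## Independent finite sampling -/

/-- The joint law of independent random variables with finitely many values. -/
def piPMF {ι α : Type} [Fintype ι] [DecidableEq ι] [Fintype α] (p : ι → PMF α) : PMF (ι → α) :=
  PMF.ofFintype (fun x => ∏ i, p i (x i)) (by
    have h := Finset.prod_univ_sum (fun _ : ι => (Finset.univ : Finset α)) (fun i a => p i a)
    rw [Fintype.piFinset_univ] at h
    rw [← h]
    refine Finset.prod_eq_one fun i _ => ?_
    rw [← tsum_fintype (L := .unconditional _)]
    exact (p i).tsum_coe)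

/-! ## The real-power model and the Hadamard test -/

section Quantum

variable {V : Type*} [NormedAddCommGroup V] [InnerProductSpace ℂ V]

variable (V) in
/-- A Hamiltonian (a self-adjoint operator) together with an initial quantum state. -/
structure QuantumInput [CompleteSpace V] where
  H : V →L[ℂ] V
  isSelfAdjoint_H : IsSelfAdjoint H
  psi : V
  norm_psi : ‖psi‖ = 1

/-- The real power `U ^ t = exp (-2 π i t H)` of the unitary `U = exp (-2 π i H)`. -/
def QuantumInput.evolution [CompleteSpace V] (Q : QuantumInput V) (t : ℝ) : V →L[ℂ] V :=
  NormedSpace.exp ((-(2 * Real.pi * t) * Complex.I : ℂ) • Q.H)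

/- A state of one ancilla qubit together with the system register is a pair of vectors `v`:
`v 0` and `v 1` are the components along the ancilla basis states `0` and `1`. -/

/-- The Hadamard gate on the ancilla. -/
def hadamardGate (v : Fin 2 → V) : Fin 2 → V :=
  ![((1 / √2 : ℝ) : ℂ) • (v 0 + v 1), ((1 / √2 : ℝ) : ℂ) • (v 0 - v 1)]

/-- The Hermitian conjugate of the phase gate on the ancilla. -/
def phaseDaggerGate (v : Fin 2 → V) : Fin 2 → V :=
  ![v 0, (-Complex.I) • v 1]

/-- The gate `A` on the system register, controlled by the ancilla. -/
def controlledGate (A : V →L[ℂ] V) (v : Fin 2 → V) : Fin 2 → V :=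
  ![v 0, A (v 1)]

/-- The final state of the Hadamard test circuit for `A` with input `x`. The flag is `false` for
the circuit that estimates the real part and `true` for the one that estimates the imaginary
part. -/
def hadamardTestState (A : V →L[ℂ] V) (x : V) (im : Bool) : Fin 2 → V :=
  let v := controlledGate A (hadamardGate ![x, 0])
  hadamardGate (if im then phaseDaggerGate v else v)


theorem hadamardGate_norm (v : Fin 2 → V) :
    ‖hadamardGate v 0‖ ^ 2 + ‖hadamardGate v 1‖ ^ 2 = ‖v 0‖ ^ 2 + ‖v 1‖ ^ 2 := by
  have h := parallelogram_law_with_norm ℂ (v 0) (v 1)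
  have h2 : ‖(((1 / √2 : ℝ)) : ℂ)‖ ^ 2 = 1 / 2 := by
    rw [Complex.norm_real, Real.norm_eq_abs, sq_abs, div_pow, Real.sq_sqrt (by norm_num)]
    norm_num
  simp only [hadamardGate, Matrix.cons_val_zero, Matrix.cons_val_one, norm_smul, mul_pow, h2]
  nlinarith [h]

theorem QuantumInput.norm_evolution [CompleteSpace V] (Q : QuantumInput V) (t : ℝ) (x : V) :
    ‖Q.evolution t x‖ = ‖x‖ := by
  have h : Q.evolution t ∈ unitary (V →L[ℂ] V) := by
    have := (selfAdjoint.expUnitary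
      ((-(2 * Real.pi * t)) • (⟨Q.H, Q.isSelfAdjoint_H⟩ : selfAdjoint (V →L[ℂ] V)))).2
    rw [selfAdjoint.expUnitary_coe] at this
    have e : (-(2 * Real.pi * t) * Complex.I : ℂ) • Q.H =
        Complex.I • (((-(2 * Real.pi * t)) • (⟨Q.H, Q.isSelfAdjoint_H⟩ : selfAdjoint (V →L[ℂ] V)) :
          selfAdjoint (V →L[ℂ] V)) : V →L[ℂ] V) := by
      ext y
      simp only [selfAdjoint.val_smul, _root_.smul_apply]
      rw [← Complex.coe_smul, smul_smul]
      congr 1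
      push_cast
      ring
    rw [QuantumInput.evolution, e]
    exact this
  exact (Q.evolution t).norm_map_of_mem_unitary h x

theorem hadamardTestState_norm [CompleteSpace V] (Q : QuantumInput V) (t : ℝ) (im : Bool) :
    ‖hadamardTestState (Q.evolution t) Q.psi im 0‖ ^ 2 +
      ‖hadamardTestState (Q.evolution t) Q.psi im 1‖ ^ 2 = 1 := by
  have h0 := hadamardGate_norm (V := V) ![Q.psi, 0]
  have hpsi := Q.norm_psi
  cases im <;>
    simp_all [hadamardTestState, hadamardGate_norm, phaseDaggerGate, controlledGate, norm_smul,
      Q.norm_evolution]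

/-- The law of the ancilla measurement at the end of the Hadamard test for `U ^ t` with the initial
state as input: the outcome `b` has probability equal to the squared norm of the component of the
final state along the ancilla basis state `b`. -/
def QuantumInput.measure [CompleteSpace V] (Q : QuantumInput V) (t : ℝ) (im : Bool) : PMF (Fin 2) :=
  PMF.ofFintype
    (fun b => ENNReal.ofReal (‖hadamardTestState (Q.evolution t) Q.psi im b‖ ^ 2)) (by
      rw [Fin.sum_univ_two, ← ENNReal.ofReal_add (by positivity) (by positivity),
        hadamardTestState_norm, ENNReal.ofReal_one])

end Quantum

/-! ## Parameters -/

/-- Parameters of the algorithm. -/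
structure Params where
  /-- lower bound for the overlaps of the dominant eigenstates -/
  β : ℝ
  /-- upper bound for the energy of the residual -/
  ω : ℝ
  /-- desired precision -/
  ε : ℝ
  /-- failure probability -/
  ρ : ℝ
  /-- error level of the signal processing routine -/
  η : ℝ
  /-- tolerance for the measured signal -/
  α : ℝ
  /-- largest frequency of the signal -/
  K : ℕ

/-- `τ = (1 / π) log (12 / (β - ω))`. -/
def tau (β ω : ℝ) : ℝ := 1 / Real.pi * Real.log (12 / (β - ω))

/-- Half of `N_HR`: the number of repetitions of each Hadamard test circuit. -/
def Params.halfShots (P : Params) : ℕ :=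
  ⌈4 / P.α ^ 2 * (Real.log (4 / P.ρ) + Real.log ((⌈Real.logb 2 (P.η / P.ε)⌉ : ℝ) + 1) +
    Real.log ((P.K : ℝ) + 1))⌉₊

/-- `η = 1 / (8 S (2 S - 1))`. -/
def etaChoice (S : ℕ) : ℝ := 1 / (8 * (S : ℝ) * (2 * (S : ℝ) - 1))

/-- The parameter choice `η = 1 / (8 S (2 S - 1))`, `K = 3 η⁻¹ τ` (rounded up to an integer). -/
def gaplessParams (S : ℕ) (β ω ε ρ α : ℝ) : Params where
  β := β
  ω := ω
  ε := ε
  ρ := ρ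
  η := etaChoice S
  α := α
  K := ⌈3 * (etaChoice S)⁻¹ * tau β ω⌉₊

/-! ## Sets of reals -/

/-- The `r`-neighbourhood of a set of reals, a union of closed intervals. -/
def nbhd (T : Set ℝ) (r : ℝ) : Set ℝ := ⋃ t ∈ T, Set.Icc (t - r) (t + r)

/-! ## Signal processing -/

/-- The circuits executed in one pass: frequency `k ∈ {0, …, K}`, real or imaginary part,
repetition. -/
abbrev Circuit (P : Params) : Type := Fin (P.K + 1) × Bool × Fin P.halfShots

/-- The average of the values `±1` read off from the outcomes (`+1` for `0`, `-1` for `1`). -/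
def average (P : Params) (o : Circuit P → Fin 2) (k : Fin (P.K + 1)) (im : Bool) : ℝ :=
  (∑ j, if o (k, im, j) = 0 then (1 : ℝ) else -1) / P.halfShots

/-- The noisy signal `y k` for `|k| ≤ K`, with `y (-k)` the conjugate of `y k`. -/
def signal (P : Params) (o : Circuit P → Fin 2) (k : ℤ) : ℂ :=
  let i : Fin (P.K + 1) := Fin.ofNat (P.K + 1) k.natAbs
  let y : ℂ := average P o i false + average P o i true * Complex.I
  if 0 ≤ k then y else (starRingEnd ℂ) y

/-- The Gaussian weights `exp (-π (k σ / K) ^ 2)` with `σ = √τ`. -/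
def gaussWeight (P : Params) (k : ℤ) : ℝ :=
  Real.exp (-Real.pi * (k * √(tau P.β P.ω) / P.K) ^ 2)

/-- The level set of the filtered signal, as a `1`-periodic subset of the line. -/
def levelSet (P : Params) (y : ℤ → ℂ) : Set ℝ :=
  {x | (6 * P.β + 5 * P.ω) / 11 * ∑' k : ℤ, gaussWeight P k <
    ‖∑ k ∈ Finset.Icc (-(P.K : ℤ)) P.K,
      y k * gaussWeight P k * Complex.exp (2 * Real.pi * Complex.I * k * x)‖}

/-- The closure of `X` with all gaps of length less than `τ / K` filled, again as a `1`-periodic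
subset of the line if `X` is one. -/
def fillGaps (P : Params) (X : Set ℝ) : Set ℝ :=
  {x | ∃ a ∈ closure X, ∃ b ∈ closure X, a ≤ x ∧ x ≤ b ∧ b - a < tau P.β P.ω / P.K}

/-- The new estimate. The set `M⁻¹ Y`, with `Y` a `1`-periodic set, is the union of the intervals
`I'ᵢ + q / M`, `q ∈ ℤ`; the new estimate is the union of those of them that meet `E`. -/
def updateEstimate (M : ℝ) (Y E : Set ℝ) : Set ℝ :=
  {x | ∃ y ∈ E, ∀ z ∈ Set.uIcc x y, M * z ∈ Y}

/-! ## The algorithm -/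

/-- The configuration of the algorithm before a test of the loop condition. -/
structure Config where
  /-- number of passes completed -/
  passes : ℕ
  /-- current amplification `M` -/
  M : ℝ
  /-- current estimate -/
  E : Set ℝ
  /-- largest runtime of a circuit executed so far -/
  tmax : ℝ
  /-- sum of the runtimes of all circuits executed so far -/
  ttotal : ℝ

/-- The initial configuration, with initial estimate `[0, 0.9]`. -/
def Config.init : Config where
  passes := 0
  M := 1
  E := Set.Icc 0 (9 / 10)
  tmax := 0
  ttotal := 0

/-- All translates of `G` by nonzero integer multiples of `1 / (M m)` are disjoint from `G`. -/
def Separates (G : Set ℝ) (M m : ℝ) : Prop :=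
  ∀ q : ℤ, q ≠ 0 → Disjoint ((fun x => x + q / (M * m)) '' G) G

/-- An admissible rule for the choice of the next amplifying factor: the factor lies in `[2, 4]`,
and it separates the translates of the `η / (2 M)`-neighbourhood of the current estimate whenever
some number in `[2, 4]` does. -/
def IsFactorRule (η : ℝ) (next : Config → ℝ) : Prop :=
  ∀ s : Config, next s ∈ Set.Icc (2 : ℝ) 4 ∧
    ((∃ m ∈ Set.Icc (2 : ℝ) 4, Separates (nbhd s.E (η / (2 * s.M))) s.M m) →
      Separates (nbhd s.E (η / (2 * s.M))) s.M (next s))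

/-- The runtime of a circuit with `U ^ (M k)` is `M k`. -/
def Circuit.runtime {P : Params} (M : ℝ) (c : Circuit P) : ℝ := M * (c.1 : ℕ)

/-- The configuration after a pass with amplification `M` and measurement outcomes `o`. -/
def Config.update (P : Params) (s : Config) (M : ℝ) (o : Circuit P → Fin 2) : Config where
  passes := s.passes + 1
  M := M
  E := updateEstimate M (fillGaps P (levelSet P (signal P o))) s.E
  tmax := Finset.univ.fold max s.tmax (fun c : Circuit P => Circuit.runtime M c)
  ttotal := s.ttotal + ∑ c : Circuit P, Circuit.runtime M c

/-- The amplification used in the next pass. -/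
def Config.nextM (next : Config → ℝ) (s : Config) : ℝ :=
  if s.passes = 0 then s.M else s.M * next s

/-- The loop condition. -/
def Config.Continues (P : Params) (s : Config) : Prop := P.ε < P.η / s.M

section Loop

variable {V : Type*} [NormedAddCommGroup V] [InnerProductSpace ℂ V] [CompleteSpace V]

open Classical in
/-- One test of the loop condition, followed by one pass through the loop body if it holds. -/
def loopStep (Q : QuantumInput V) (P : Params) (next : Config → ℝ) (s : Config) : PMF Config :=
  if s.Continues P then
    (piPMF fun c : Circuit P => Q.measure (Circuit.runtime (s.nextM next) c) c.2.1).map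
      (s.update P (s.nextM next))
  else
    PMF.pure s

/-- The law of the configuration after `n` iterations of `loopStep`. Once the loop condition fails,
the configuration is the output of the algorithm and no longer changes. -/
def run (Q : QuantumInput V) (P : Params) (next : Config → ℝ) : ℕ → PMF Config
  | 0 => PMF.pure Config.init
  | n + 1 => (run Q P next n).bind (loopStep Q P next)

end Loop

/-! ## The estimation problem -/

section Problem

variable {V : Type*} [NormedAddCommGroup V] [InnerProductSpace ℂ V] [CompleteSpace V]

/-- The initial state is `∑ s, c s • φ s + r` with orthonormal eigenvectors `φ s` of the Hamiltonian
for the eigenvalues `lam s`, overlaps `|c s| ^ 2 ≥ β`, and a residual `r`, orthogonal to all the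
`φ s`, with energy at most `ω`. -/
def HasDominantEigenvalues (Q : QuantumInput V) (S : ℕ) (lam : Fin S → ℝ) (β ω : ℝ) : Prop :=
  ∃ (φ : Fin S → V) (c : Fin S → ℂ) (r : V),
    Orthonormal ℂ φ ∧ (∀ s, Q.H (φ s) = (lam s : ℂ) • φ s) ∧
    Q.psi = ∑ s, c s • φ s + r ∧ (∀ s, inner ℂ (φ s) r = 0) ∧
    (∀ s, β ≤ ‖c s‖ ^ 2) ∧ ‖r‖ ^ 2 ≤ ω

end Problem

/-- The logarithmic quantity, bounded below by `1`, whose powers `Õ` hides. -/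
def logFactor (S : ℕ) (β ω ε ρ : ℝ) : ℝ :=
  1 + Real.log S + Real.log (1 / (β - ω)) + Real.log (1 / ε) + Real.log (1 / ρ)

end

end RMPE

namespace RMPE

noncomputable section

/-! ## Periodized Gaussians -/

/-! The signal `⟨ψ, U^t ψ⟩` is the Fourier transform of a probability distribution with mass at
least `β` at each dominant eigenvalue and mass at most `ω` elsewhere
(`HasDominantEigenvalues.exists_weights`). By Poisson summation, Gaussian weights turn this mixture
of exponentials into a mixture of periodized Gaussians. Relative to the total weight, truncation
costs `(β - ω) / 12` and noise costs `α < (β - ω) / 3`. The filtered signal therefore exceeds the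
threshold at every amplified eigenvalue and stays below it at distance `τ / K` or more from all
their integer translates (`mem_levelSet_of_le_weight`, `exists_of_mem_levelSet`).

Undoing the amplification leaves an ambiguity modulo `1 / M`. A component that meets the old
estimate cannot reach a false translate if the translates of a neighbourhood of that estimate are
disjoint (`updateEstimate_subset`). Without a gap assumption, a suitable factor in `[2, 4]` exists
by a measure argument: each pair of eigenvalues spoils only a set of reciprocals `1 / m` of measure
`O(η)`, there are `S (S - 1) / 2` pairs, and `η` is chosen so that they cannot fill `(1/4, 1/2)`
(`exists_nonresonant`).

Hoeffding's inequality and a union bound over the tests of one pass give failure probability at most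
`ρ` divided by the maximal number of passes; the passes are then summed
(`toOuterMeasure_not_correct_le`).

The runtime bounds are deterministic. After the first pass `M` at least doubles each time, so the
total cost is at most twice that of a pass at the final `M`, and that `M` is at most `4 η / ε`.
Since `η K` is logarithmic, the largest runtime has no factor `S`, while `η K ^ 2 = (η K) ^ 2 / η`
produces the factor `S ^ 2` in the total. -/

theorem summable_exp_neg_pi_mul_int_sub_sq {b : ℝ} (hb : 0 < b) (x : ℝ) :
    Summable fun n : ℤ => Real.exp (-Real.pi * b * (n - x) ^ 2) := by
  have h := summable_pow_mul_jacobiTheta₂_term_bound (|b * x|) hb 0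
  have h2 := h.mul_left (Real.exp (-Real.pi * b * x ^ 2))
  refine Summable.of_nonneg_of_le (fun _ => (Real.exp_pos _).le) (fun n => ?_) h2
  simp only [pow_zero, one_mul]
  rw [← Real.exp_add]
  apply Real.exp_le_exp.mpr
  have : b * x * n ≤ |b * x| * |(n : ℝ)| := by
    rw [← abs_mul]; exact le_abs_self _
  have hpi := Real.pi_pos
  push_cast
  nlinarith

/-- The periodization of the Gaussian `exp (-π b x ^ 2)`. -/
def periodizedGauss (b x : ℝ) : ℝ := ∑' n : ℤ, Real.exp (-Real.pi * b * (n - x) ^ 2)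

theorem periodizedGauss_nonneg (b x : ℝ) : 0 ≤ periodizedGauss b x :=
  tsum_nonneg fun _ => (Real.exp_pos _).le

theorem one_le_periodizedGauss_zero {b : ℝ} (hb : 0 < b) : 1 ≤ periodizedGauss b 0 := by
  have h := (summable_exp_neg_pi_mul_int_sub_sq hb 0).le_tsum 0
    (fun _ _ => (Real.exp_pos _).le)
  simpa [periodizedGauss] using h

theorem periodizedGauss_add_int (b x : ℝ) (q : ℤ) :
    periodizedGauss b (x + q) = periodizedGauss b x := by
  unfold periodizedGauss
  rw [← (Equiv.addRight q).tsum_eq]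
  refine tsum_congr fun n => ?_
  simp only [Equiv.coe_addRight]
  push_cast
  congr 2
  ring

/-- Poisson summation for a Gaussian. -/
theorem tsum_gauss_mul_exp {b : ℝ} (hb : 0 < b) (x : ℝ) :
    ∑' k : ℤ, ((Real.exp (-Real.pi * b⁻¹ * k ^ 2) : ℝ) : ℂ) *
      Complex.exp (2 * Real.pi * Complex.I * k * x) =
      ((√b * periodizedGauss b x : ℝ) : ℂ) := by
  have h := Complex.tsum_exp_neg_quadratic (a := ((b⁻¹ : ℝ) : ℂ))
    (by simpa using hb) (Complex.I * x)
  have e : 1 / ((b⁻¹ : ℝ) : ℂ) ^ (1 / 2 : ℂ) = ((√b : ℝ) : ℂ) := by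
    have : (1 / 2 : ℂ) = ((1 / 2 : ℝ) : ℂ) := by push_cast; rfl
    rw [this, ← Complex.ofReal_cpow (by positivity), ← Real.sqrt_eq_rpow, Real.sqrt_inv]
    push_cast
    simp
  rw [e] at h
  rw [Complex.ofReal_mul, periodizedGauss, Complex.ofReal_tsum]
  refine (tsum_congr fun k => ?_).trans (h.trans (congrArg _ (tsum_congr fun n => ?_)))
  · rw [Complex.ofReal_exp, ← Complex.exp_add]
    congr 1
    push_cast
    ring
  · rw [Complex.ofReal_exp]
    congr 1
    have : (n : ℂ) + Complex.I * (Complex.I * x) = n - x := by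
      rw [← mul_assoc, Complex.I_mul_I]; ring
    rw [this]
    push_cast
    have hb' : (b : ℂ) ≠ 0 := by exact_mod_cast hb.ne'
    field_simp

theorem tsum_gauss {b : ℝ} (hb : 0 < b) :
    ∑' k : ℤ, Real.exp (-Real.pi * b⁻¹ * k ^ 2) = √b * periodizedGauss b 0 := by
  have h := tsum_gauss_mul_exp hb 0
  simp only [Complex.ofReal_zero, mul_zero, Complex.exp_zero, mul_one] at h
  rw [← Complex.ofReal_tsum] at h
  exact_mod_cast h

/-- The Fourier coefficients are positive, so the triangle inequality applied to the Fourier series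
is an equality at `0`. -/
theorem periodizedGauss_le_zero {b : ℝ} (hb : 0 < b) (x : ℝ) :
    periodizedGauss b x ≤ periodizedGauss b 0 := by
  have hs : Summable fun k : ℤ => Real.exp (-Real.pi * b⁻¹ * k ^ 2) := by
    simpa using summable_exp_neg_pi_mul_int_sub_sq (inv_pos.mpr hb) 0
  have hn : ∀ k : ℤ, ‖((Real.exp (-Real.pi * b⁻¹ * k ^ 2) : ℝ) : ℂ) *
      Complex.exp (2 * Real.pi * Complex.I * k * x)‖ = Real.exp (-Real.pi * b⁻¹ * k ^ 2) :=
    fun k => by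
    rw [norm_mul, show (2 * Real.pi * Complex.I * k * x : ℂ) =
      ((2 * Real.pi * k * x : ℝ) : ℂ) * Complex.I by push_cast; ring,
      Complex.norm_exp_ofReal_mul_I, mul_one, Complex.norm_real, Real.norm_eq_abs, Real.abs_exp]
  have h := norm_tsum_le_tsum_norm (f := fun k : ℤ => ((Real.exp (-Real.pi * b⁻¹ * k ^ 2) : ℝ) : ℂ) *
      Complex.exp (2 * Real.pi * Complex.I * k * x)) (by simpa only [hn])
  simp only [hn] at h
  rw [tsum_gauss_mul_exp hb, tsum_gauss hb, Complex.norm_real, Real.norm_eq_abs, abs_of_nonneg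
    (mul_nonneg (Real.sqrt_nonneg _) (periodizedGauss_nonneg _ _))] at h
  exact le_of_mul_le_mul_left h (Real.sqrt_pos.mpr hb)

theorem tsum_int_le_of_geometric {f : ℤ → ℝ} {q : ℝ} (hf : Summable f) (hq0 : 0 ≤ q) (hq1 : q < 1)
    (h : ∀ n : ℤ, n ≠ 0 → f n ≤ q ^ n.natAbs) :
    ∑' n, f n ≤ f 0 + (q / (1 - q) + q / (1 - q)) := by
  have hg : HasSum (fun n : ℕ => q ^ (n + 1)) (q / (1 - q)) := by
    have := (hasSum_geometric_of_lt_one hq0 hq1).mul_left q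
    simpa [pow_succ', div_eq_mul_inv] using this
  have s1 : Summable fun n : ℕ => f (n + 1) :=
    hf.comp_injective (i := fun n : ℕ => (n + 1 : ℤ)) fun a b hab => by simpa using hab
  have s2 : Summable fun n : ℕ => f (-(n + 1)) :=
    hf.comp_injective (i := fun n : ℕ => (-(n + 1) : ℤ)) fun a b hab => by simpa using hab
  have a1 : ∑' n : ℕ, f (n + 1) ≤ q / (1 - q) := by
    rw [← hg.tsum_eq]
    refine s1.tsum_le_tsum (fun n => ?_) hg.summable
    have := h (n + 1) (by omega)
    rwa [show (n + 1 : ℤ).natAbs = n + 1 by omega] at this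
  have a2 : ∑' n : ℕ, f (-(n + 1)) ≤ q / (1 - q) := by
    rw [← hg.tsum_eq]
    refine s2.tsum_le_tsum (fun n => ?_) hg.summable
    have := h (-(n + 1)) (by omega)
    rwa [show (-(n + 1 : ℤ)).natAbs = n + 1 by omega] at this
  rw [tsum_of_add_one_of_neg_add_one s1 s2]
  linarith

/-- Away from the integers, a narrow periodized Gaussian is small. -/
theorem periodizedGauss_le {b τ x : ℝ} {u : ℝ} (hu0 : 0 < u) (hu : u ≤ 1 / 12)
    (hτ : u = Real.exp (-Real.pi * τ)) (hb : 8 * τ ≤ b) (hτ0 : 0 < τ)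
    (hx : ∀ n : ℤ, τ ≤ b * (x - n) ^ 2) :
    periodizedGauss b x ≤ 6 / 5 * u := by
  have hb0 : 0 < b := by linarith
  wlog hx2 : |x| ≤ 1 / 2 generalizing x
  · have h := this (x := x - round x) (fun n => by
      have := hx (round x + n)
      push_cast at this
      rwa [← sub_sub] at this) (abs_sub_round x)
    rw [← periodizedGauss_add_int b _ (round x)] at h
    simpa using h
  set q := u ^ 2 with hq
  have hq0 : 0 < q := by positivity
  have hq1 : q ≤ 1 / 144 := by rw [hq]; nlinarith
  -- the terms with `n ≠ 0`
  have key : ∀ n : ℤ, n ≠ 0 → Real.exp (-Real.pi * b * (n - x) ^ 2) ≤ q ^ n.natAbs := by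
    intro n hn
    rw [hq, hτ, ← Real.exp_nat_mul, ← Real.exp_nat_mul]
    apply Real.exp_le_exp.mpr
    have h1 : (1 : ℝ) ≤ |(n : ℝ)| := by exact_mod_cast Int.one_le_abs hn
    have h2 : |(n : ℝ)| - 1 / 2 ≤ |n - x| := by
      have := abs_sub_abs_le_abs_sub (n : ℝ) x
      linarith
    -- With `|x| ≤ 1 / 2` this is `(|n| - 1) (|n| - 1 / 4) ≥ 0`. It trades the quadratic exponent
    -- for a linear one, so that a geometric series of ratio `u ^ 2` dominates.
    have h3 : |(n : ℝ)| / 4 ≤ (n - x) ^ 2 := by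
      rw [← sq_abs (n - x)]
      nlinarith
    have h4 : ((n.natAbs : ℕ) : ℝ) = |(n : ℝ)| := by simp [Nat.cast_natAbs]
    rw [h4]
    push_cast
    have h5 : 2 * τ * |(n : ℝ)| ≤ b * (n - x) ^ 2 := by
      calc 2 * τ * |(n : ℝ)| = 8 * τ * (|(n : ℝ)| / 4) := by ring
        _ ≤ b * (n - x) ^ 2 := by gcongr
    nlinarith [Real.pi_pos]
  have key0 : Real.exp (-Real.pi * b * ((0 : ℤ) - x) ^ 2) ≤ u := by
    rw [hτ]
    apply Real.exp_le_exp.mpr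
    have := hx 0
    push_cast at this ⊢
    nlinarith [Real.pi_pos]
  have hle := tsum_int_le_of_geometric (summable_exp_neg_pi_mul_int_sub_sq hb0 x) hq0.le
    (by linarith) key
  change periodizedGauss b x ≤ _ at hle
  replace hle := hle.trans (add_le_add key0 le_rfl)
  -- From `u ≤ 1 / 12`; the two tails then add at most `u / 5` to the central term `u`.
  have : q / (1 - q) ≤ u / 10 := by
    rw [div_le_iff₀ (by linarith), hq]
    nlinarith
  linarith

/-- Tail bound for the Gaussian weights. -/
theorem tsum_gauss_tail_le {τ : ℝ} (hτ : 1 / 4 ≤ τ) {K : ℕ} (hK : 0 < K) :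
    ∑' n : ℕ, Real.exp (-Real.pi * (τ / K ^ 2) * ((K : ℝ) + (n + 1)) ^ 2) ≤
      Real.exp (-Real.pi * τ) * (K / (2 * Real.pi * τ)) := by
  have hK' : (0 : ℝ) < K := by exact_mod_cast hK
  have hpi := Real.pi_pos
  have hτ0 : 0 < τ := by linarith
  set v := 2 * Real.pi * τ / K with hv
  have hv0 : 0 < v := by positivity
  set q := Real.exp (-v) with hq
  have hq0 : 0 < q := Real.exp_pos _
  have hq1 : q < 1 := by rw [hq, ← Real.exp_zero]; exact Real.exp_lt_exp.mpr (by linarith)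
  have hg : HasSum (fun n : ℕ => Real.exp (-Real.pi * τ) * q ^ (n + 1))
      (Real.exp (-Real.pi * τ) * (q / (1 - q))) := by
    have := (hasSum_geometric_of_lt_one hq0.le hq1).mul_left q
    apply HasSum.mul_left
    simpa [pow_succ', div_eq_mul_inv] using this
  have hle : ∀ n : ℕ, Real.exp (-Real.pi * (τ / K ^ 2) * ((K : ℝ) + (n + 1)) ^ 2) ≤
      Real.exp (-Real.pi * τ) * q ^ (n + 1) := by
    intro n
    rw [hq, ← Real.exp_nat_mul, ← Real.exp_add]
    apply Real.exp_le_exp.mpr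
    -- Expanding the square isolates `exp (-π τ)` and a geometric factor; the remaining square only
    -- helps and is dropped.
    have e : -Real.pi * (τ / K ^ 2) * ((K : ℝ) + (n + 1)) ^ 2 =
      -Real.pi * τ + (n + 1 : ℕ) * -v - Real.pi * (τ / K ^ 2) * (n + 1) ^ 2 := by
      rw [hv]; push_cast; field_simp; ring
    rw [e]
    have : 0 ≤ Real.pi * (τ / K ^ 2) * (n + 1) ^ 2 := by positivity
    linarith
  calc _ ≤ ∑' n : ℕ, Real.exp (-Real.pi * τ) * q ^ (n + 1) :=
        Summable.tsum_le_tsum hle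
          (Summable.of_nonneg_of_le (fun _ => (Real.exp_pos _).le) hle hg.summable) hg.summable
    _ = Real.exp (-Real.pi * τ) * (q / (1 - q)) := hg.tsum_eq
    _ ≤ _ := by
      refine mul_le_mul_of_nonneg_left ?_ (Real.exp_pos _).le
      have : (K : ℝ) / (2 * Real.pi * τ) = v⁻¹ := by rw [hv, inv_div]
      rw [this, div_le_iff₀ (by linarith), ← div_eq_inv_mul, le_div_iff₀ hv0]
      have h1 : q * Real.exp v = 1 := by rw [hq, ← Real.exp_add]; simp
      have h2 := Real.add_one_le_exp v
      nlinarith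

/-! ## The filtered signal -/

/-- For an even summable family, the sum over `|k| > K` is twice the one-sided tail. -/
theorem tsum_sub_sum_Icc_of_even {f : ℤ → ℝ} (hf : Summable f) (he : f.Even) (K : ℕ) :
    ∑' k, f k - ∑ k ∈ Finset.Icc (-(K : ℤ)) K, f k = 2 * ∑' n : ℕ, f (K + (n + 1)) := by
  have s0 : Summable fun n : ℕ => f n := hf.comp_injective Nat.cast_injective
  have s1 : Summable fun n : ℕ => f (n + 1) :=
    hf.comp_injective (i := fun n : ℕ => (n + 1 : ℤ)) fun a b hab => by simpa using hab
  have e : ∀ n : ℕ, f (-(n + 1)) = f (n + 1) := fun n => he _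
  rw [Finset.sum_Icc_of_even_eq_range he, tsum_of_add_one_of_neg_add_one s1 (by simpa only [e])]
  simp only [e]
  have h1 := s0.sum_add_tsum_nat_add (K + 1)
  have h2 := s0.sum_add_tsum_nat_add 1
  simp only [Finset.range_one, Finset.sum_singleton, Nat.cast_zero, Nat.cast_add, Nat.cast_one]
    at h1 h2
  have h3 : ∑' n : ℕ, f (K + (n + 1)) = ∑' n : ℕ, f (n + (K + 1)) :=
    tsum_congr fun n => by congr 1; ring
  rw [h3]
  simp only [nsmul_eq_mul, Nat.cast_ofNat]
  linarith

section Params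

variable {P : Params}

theorem exp_neg_pi_mul_tau (hD : 0 < P.β - P.ω) :
    Real.exp (-Real.pi * tau P.β P.ω) = (P.β - P.ω) / 12 := by
  have : -Real.pi * tau P.β P.ω = -Real.log (12 / (P.β - P.ω)) := by
    rw [tau]; field_simp [Real.pi_ne_zero]
  rw [this, Real.exp_neg, Real.exp_log (by positivity), inv_div]

theorem one_div_four_le_tau {β ω : ℝ} (hD : 0 < β - ω) (hD1 : β - ω ≤ 1) : 1 / 4 ≤ tau β ω := by
  have h1 : 1 ≤ Real.log (12 / (β - ω)) := by
    rw [Real.le_log_iff_exp_le (by positivity), le_div_iff₀ hD]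
    have := Real.exp_one_lt_d9
    nlinarith [Real.exp_pos 1]
  rw [tau, div_mul_eq_mul_div, one_mul, div_le_div_iff₀ (by norm_num) Real.pi_pos]
  linarith [Real.pi_lt_four]

/-- The inverse width of the Gaussian weights. -/
def invWidth (P : Params) : ℝ := (P.K : ℝ) ^ 2 / tau P.β P.ω

theorem gaussWeight_eq (hD : 0 < P.β - P.ω) (hD1 : P.β - P.ω ≤ 1) (k : ℤ) :
    gaussWeight P k = Real.exp (-Real.pi * (invWidth P)⁻¹ * k ^ 2) := by
  have := one_div_four_le_tau hD hD1
  rw [gaussWeight, invWidth, div_pow, mul_pow, Real.sq_sqrt (by linarith), inv_div]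
  congr 1
  ring

theorem gaussWeight_pos (P : Params) (k : ℤ) : 0 < gaussWeight P k := Real.exp_pos _

variable (hD : 0 < P.β - P.ω) (hD1 : P.β - P.ω ≤ 1) (hK : 24 * tau P.β P.ω ≤ P.K)
include hD hD1 hK

theorem cast_K_pos : (0 : ℝ) < P.K := by linarith [one_div_four_le_tau hD hD1]

theorem invWidth_pos : 0 < invWidth P := by
  have := one_div_four_le_tau hD hD1
  have := cast_K_pos hD hD1 hK
  unfold invWidth
  positivity

theorem summable_gaussWeight : Summable (gaussWeight P) := by
  have h := summable_exp_neg_pi_mul_int_sub_sq (inv_pos.mpr (invWidth_pos hD hD1 hK)) 0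
  simp only [sub_zero] at h
  exact h.congr fun k => (gaussWeight_eq hD hD1 k).symm

theorem tsum_gaussWeight :
    ∑' k, gaussWeight P k = √(invWidth P) * periodizedGauss (invWidth P) 0 := by
  rw [← tsum_gauss (invWidth_pos hD hD1 hK)]
  exact tsum_congr fun k => gaussWeight_eq hD hD1 k

theorem tsum_gaussWeight_pos : 0 < ∑' k, gaussWeight P k := by
  have h := invWidth_pos hD hD1 hK
  have := one_le_periodizedGauss_zero h
  rw [tsum_gaussWeight hD hD1 hK]
  positivity

/-- This is where `τ` is calibrated: `exp (-π τ) = (β - ω) / 12`. The remaining factor `K / (π τ)`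
of the tail is absorbed by the total weight, which is at least `√(invWidth P) = K / √τ`. -/
theorem gaussWeight_tail_le :
    ∑' k, gaussWeight P k - ∑ k ∈ Finset.Icc (-(P.K : ℤ)) P.K, gaussWeight P k ≤
      (P.β - P.ω) / 12 * ∑' k, gaussWeight P k := by
  have hτ := one_div_four_le_tau hD hD1
  have hK0 := cast_K_pos hD hD1 hK
  have hb := invWidth_pos hD hD1 hK
  have he : (gaussWeight P).Even := fun k => by simp [gaussWeight, neg_div]
  rw [tsum_sub_sum_Icc_of_even (summable_gaussWeight hD hD1 hK) he]
  have h1 := tsum_gauss_tail_le hτ (K := P.K) (by exact_mod_cast hK0)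
  have h2 : ∑' n : ℕ, gaussWeight P (P.K + (n + 1)) =
      ∑' n : ℕ, Real.exp (-Real.pi * (tau P.β P.ω / P.K ^ 2) * ((P.K : ℝ) + (n + 1)) ^ 2) :=
    tsum_congr fun n => by rw [gaussWeight_eq hD hD1, invWidth, inv_div]; push_cast; rfl
  rw [exp_neg_pi_mul_tau hD] at h1
  rw [h2]
  have h3 : √(invWidth P) ≤ ∑' k, gaussWeight P k := by
    rw [tsum_gaussWeight hD hD1 hK]
    exact le_mul_of_one_le_right (Real.sqrt_nonneg _) (one_le_periodizedGauss_zero hb)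
  have h4 : (P.K : ℝ) / (Real.pi * tau P.β P.ω) ≤ √(invWidth P) := by
    apply Real.le_sqrt_of_sq_le
    rw [invWidth, div_pow, mul_pow]
    apply div_le_div_of_nonneg_left (by positivity) (by linarith)
    have h5 : 1 ≤ Real.pi ^ 2 * tau P.β P.ω := by nlinarith [Real.pi_gt_three]
    nlinarith
  calc _ ≤ 2 * ((P.β - P.ω) / 12 * (P.K / (2 * Real.pi * tau P.β P.ω))) := by gcongr
    _ = (P.β - P.ω) / 12 * (P.K / (Real.pi * tau P.β P.ω)) := by
      have : tau P.β P.ω ≠ 0 := by linarith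
      field_simp
    _ ≤ _ := by gcongr; exact h4.trans h3

/-- The truncated trigonometric sum of the Gaussian weights is close to a periodized Gaussian. -/
theorem norm_sum_gaussWeight_sub_le (x : ℝ) :
    ‖∑ k ∈ Finset.Icc (-(P.K : ℤ)) P.K, (gaussWeight P k : ℂ) *
        Complex.exp (2 * Real.pi * Complex.I * k * x) -
      ((√(invWidth P) * periodizedGauss (invWidth P) x : ℝ) : ℂ)‖ ≤
      (P.β - P.ω) / 12 * ∑' k, gaussWeight P k := by
  refine le_trans ?_ (gaussWeight_tail_le hD hD1 hK)
  set s := Finset.Icc (-(P.K : ℤ)) P.K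
  have hs := summable_gaussWeight hD hD1 hK
  have hn : ∀ k : ℤ, ‖(gaussWeight P k : ℂ) * Complex.exp (2 * Real.pi * Complex.I * k * x)‖ =
      gaussWeight P k := fun k => by
    rw [norm_mul, show (2 * Real.pi * Complex.I * k * x : ℂ) =
      ((2 * Real.pi * k * x : ℝ) : ℂ) * Complex.I by push_cast; ring,
      Complex.norm_exp_ofReal_mul_I, mul_one, Complex.norm_real, Real.norm_eq_abs,
      abs_of_pos (gaussWeight_pos P k)]
  have hs' : Summable fun k : ℤ =>
      (gaussWeight P k : ℂ) * Complex.exp (2 * Real.pi * Complex.I * k * x) :=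
    Summable.of_norm (by simpa only [hn])
  have e1 := tsum_gauss_mul_exp (invWidth_pos hD hD1 hK) x
  simp only [← gaussWeight_eq hD hD1] at e1
  rw [← e1, ← hs'.sum_add_tsum_compl (s := s), ← hs.sum_add_tsum_compl (s := s), sub_add_cancel_left,
    norm_neg, add_sub_cancel_left]
  refine (norm_tsum_le_tsum_norm ?_).trans_eq ?_
  · simp only [hn]; exact hs.subtype _
  · simp only [hn]

/-! ### Level sets of a filtered mixture of exponentials. -/

section Spectral

variable {J : Type*} [Fintype J] {wt ν : J → ℝ} {y : ℤ → ℂ} {α : ℝ}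
  (hwt : ∀ j, 0 ≤ wt j) (hwt1 : ∑ j, wt j = 1)
  (hy : ∀ k ∈ Finset.Icc (-(P.K : ℤ)) P.K,
    ‖y k - ∑ j, (wt j : ℂ) * Complex.exp (-(2 * Real.pi * Complex.I * k * ν j))‖ ≤ α)
include hwt hwt1 hy

/-- Noise contributes `α` per unit of weight. The truncation errors of the individual exponentials
are averaged by `wt`, so their number does not enter. -/
theorem norm_filtered_sub_le (hα : 0 ≤ α) (x : ℝ) :
    ‖∑ k ∈ Finset.Icc (-(P.K : ℤ)) P.K, y k * gaussWeight P k *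
        Complex.exp (2 * Real.pi * Complex.I * k * x) -
      ((∑ j, wt j * (√(invWidth P) * periodizedGauss (invWidth P) (x - ν j)) : ℝ) : ℂ)‖ ≤
      (α + (P.β - P.ω) / 12) * ∑' k, gaussWeight P k := by
  set s := Finset.Icc (-(P.K : ℤ)) P.K
  have hs := summable_gaussWeight hD hD1 hK
  set g : ℤ → ℂ := fun k =>
    ∑ j, (wt j : ℂ) * Complex.exp (-(2 * Real.pi * Complex.I * k * ν j)) with hg
  have e1 : ∑ k ∈ s, y k * gaussWeight P k * Complex.exp (2 * Real.pi * Complex.I * k * x) =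
      ∑ k ∈ s, (y k - g k) * gaussWeight P k * Complex.exp (2 * Real.pi * Complex.I * k * x) +
      ∑ j, (wt j : ℂ) * ∑ k ∈ s, (gaussWeight P k : ℂ) *
        Complex.exp (2 * Real.pi * Complex.I * k * (x - ν j : ℝ)) := by
    simp only [Finset.mul_sum]
    rw [Finset.sum_comm, ← Finset.sum_add_distrib]
    refine Finset.sum_congr rfl fun k _ => ?_
    have : ∑ j, (wt j : ℂ) * ((gaussWeight P k : ℂ) *
        Complex.exp (2 * Real.pi * Complex.I * k * (x - ν j : ℝ))) =
        g k * gaussWeight P k * Complex.exp (2 * Real.pi * Complex.I * k * x) := by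
      rw [hg, Finset.sum_mul, Finset.sum_mul]
      refine Finset.sum_congr rfl fun j _ => ?_
      have : (2 * Real.pi * Complex.I * k * (x - ν j : ℝ) : ℂ) =
        -(2 * Real.pi * Complex.I * k * ν j) + 2 * Real.pi * Complex.I * k * x := by
        push_cast; ring
      rw [this, Complex.exp_add]
      ring
    rw [this]
    ring
  rw [e1, Complex.ofReal_sum, add_sub_assoc, ← Finset.sum_sub_distrib, add_mul]
  refine (norm_add_le _ _).trans (add_le_add ?_ ?_)
  · refine (norm_sum_le _ _).trans ((Finset.sum_le_sum (g := fun k => α * gaussWeight P k)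
      fun k hk => ?_).trans ?_)
    · rw [norm_mul, norm_mul, show (2 * Real.pi * Complex.I * k * x : ℂ) =
        ((2 * Real.pi * k * x : ℝ) : ℂ) * Complex.I by push_cast; ring,
        Complex.norm_exp_ofReal_mul_I, mul_one, Complex.norm_real, Real.norm_eq_abs,
        abs_of_pos (gaussWeight_pos P k)]
      exact mul_le_mul_of_nonneg_right (hy k hk) (gaussWeight_pos P k).le
    · rw [← Finset.mul_sum]
      exact mul_le_mul_of_nonneg_left
        (hs.sum_le_tsum _ fun k _ => (gaussWeight_pos P k).le) hα
  · refine (norm_sum_le _ _).trans ((Finset.sum_le_sum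
      (g := fun j => wt j * ((P.β - P.ω) / 12 * ∑' k, gaussWeight P k)) fun j _ => ?_).trans ?_)
    · rw [Complex.ofReal_mul, ← mul_sub, norm_mul, Complex.norm_real, Real.norm_eq_abs,
        abs_of_nonneg (hwt j)]
      exact mul_le_mul_of_nonneg_left (norm_sum_gaussWeight_sub_le hD hD1 hK _) (hwt j)
    · rw [← Finset.sum_mul, hwt1, one_mul]

/-- The term of index `j` alone contributes `β`. The errors remove less than `(1/12 + 1/3) (β - ω) =
5/12 (β - ω)`, whereas the threshold lies `5/11 (β - ω)` below `β`. -/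
theorem mem_levelSet_of_le_weight (hα0 : 0 ≤ α) (hα : α < (P.β - P.ω) / 3) {j : J}
    (hj : P.β ≤ wt j) (q : ℤ) : ν j + q ∈ levelSet P y := by
  have h := norm_filtered_sub_le hD hD1 hK hwt hwt1 hy hα0 (ν j + q)
  have hZ := tsum_gaussWeight_pos hD hD1 hK
  have hZe := tsum_gaussWeight hD hD1 hK
  set F := ∑ k ∈ Finset.Icc (-(P.K : ℤ)) P.K, y k * gaussWeight P k *
        Complex.exp (2 * Real.pi * Complex.I * k * (ν j + q : ℝ)) with hF
  have h1 : P.β * ∑' k, gaussWeight P k ≤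
      ∑ i, wt i * (√(invWidth P) * periodizedGauss (invWidth P) (ν j + q - ν i)) := by
    have h2 := Finset.single_le_sum (f := fun i =>
      wt i * (√(invWidth P) * periodizedGauss (invWidth P) (ν j + q - ν i)))
      (fun i _ => mul_nonneg (hwt i) (mul_nonneg (Real.sqrt_nonneg _) (periodizedGauss_nonneg _ _)))
      (Finset.mem_univ j)
    refine le_trans ?_ h2
    have h3 : ν j + q - ν j = 0 + q := by ring
    rw [h3, periodizedGauss_add_int, ← hZe]
    exact mul_le_mul_of_nonneg_right hj hZ.le
  set G := ∑ i, wt i * (√(invWidth P) * periodizedGauss (invWidth P) (ν j + q - ν i))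
  have h4 : G - ‖F‖ ≤ ‖F - (G : ℂ)‖ := by
    have h5 := norm_sub_norm_le (G : ℂ) F
    rw [norm_sub_rev, Complex.norm_real, Real.norm_eq_abs] at h5
    linarith [le_abs_self G]
  change _ < ‖F‖
  nlinarith

/-- Far from every dominant frequency, the dominant part contributes at most `(β - ω) / 10` and the
rest at most `ω`. With the errors this is below `ω + 31/60 (β - ω)`, and the threshold is `ω + 6/11
(β - ω)`. -/
theorem exists_of_mem_levelSet (hα0 : 0 ≤ α) (hα : α < (P.β - P.ω) / 3) {dom : J → Prop}
    [DecidablePred dom] (hdom : ∑ j with ¬ dom j, wt j ≤ P.ω) {x : ℝ} (hx : x ∈ levelSet P y) :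
    ∃ j, dom j ∧ ∃ q : ℤ, |x - (ν j + q)| < tau P.β P.ω / P.K := by
  by_contra! hcon
  have hτ := one_div_four_le_tau hD hD1
  have hK0 := cast_K_pos hD hD1 hK
  have hb0 := invWidth_pos hD hD1 hK
  have h := norm_filtered_sub_le hD hD1 hK hwt hwt1 hy hα0 x
  have hZ := tsum_gaussWeight_pos hD hD1 hK
  have hZe := tsum_gaussWeight hD hD1 hK
  have hZ1 : √(invWidth P) ≤ ∑' k, gaussWeight P k := by
    rw [tsum_gaussWeight hD hD1 hK]
    exact le_mul_of_one_le_right (Real.sqrt_nonneg _) (one_le_periodizedGauss_zero hb0)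
  set Z := ∑' k, gaussWeight P k
  have hsmall : ∀ j, dom j →
      √(invWidth P) * periodizedGauss (invWidth P) (x - ν j) ≤ (P.β - P.ω) / 10 * Z := by
    intro j hj
    have h1 : periodizedGauss (invWidth P) (x - ν j) ≤ 6 / 5 * ((P.β - P.ω) / 12) := by
      refine periodizedGauss_le (τ := tau P.β P.ω) (by linarith) (by linarith)
        (exp_neg_pi_mul_tau hD).symm ?_ (by linarith) fun n => ?_
      · rw [invWidth, le_div_iff₀ (by linarith)]
        nlinarith
      · have h2 := hcon j hj n
        have h3 : (tau P.β P.ω / P.K) ^ 2 ≤ (x - ν j - n) ^ 2 := by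
          rw [← sq_abs (x - ν j - n), sub_sub]
          exact pow_le_pow_left₀ (by positivity) h2 2
        calc tau P.β P.ω = invWidth P * (tau P.β P.ω / P.K) ^ 2 := by
              rw [invWidth]
              have : tau P.β P.ω ≠ 0 := by linarith
              field_simp
          _ ≤ _ := by gcongr
    calc _ ≤ √(invWidth P) * (6 / 5 * ((P.β - P.ω) / 12)) := by gcongr
      _ = (P.β - P.ω) / 10 * √(invWidth P) := by ring
      _ ≤ _ := by gcongr
  have hall : ∀ j, √(invWidth P) * periodizedGauss (invWidth P) (x - ν j) ≤ Z := fun j => by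
    rw [hZe]
    exact mul_le_mul_of_nonneg_left (periodizedGauss_le_zero hb0 _) (Real.sqrt_nonneg _)
  have hsum : ∑ j, wt j * (√(invWidth P) * periodizedGauss (invWidth P) (x - ν j)) ≤
      (P.β - P.ω) / 10 * Z + P.ω * Z := by
    rw [← Finset.sum_filter_add_sum_filter_not Finset.univ dom]
    refine add_le_add ?_ ?_
    · calc _ ≤ ∑ j with dom j, wt j * ((P.β - P.ω) / 10 * Z) :=
            Finset.sum_le_sum fun j hj =>
              mul_le_mul_of_nonneg_left (hsmall j (Finset.mem_filter.mp hj).2) (hwt j)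
        _ = (∑ j with dom j, wt j) * ((P.β - P.ω) / 10 * Z) := by rw [Finset.sum_mul]
        _ ≤ 1 * ((P.β - P.ω) / 10 * Z) := by
          refine mul_le_mul_of_nonneg_right ?_ (by positivity)
          rw [← hwt1]
          exact Finset.sum_le_sum_of_subset_of_nonneg (Finset.filter_subset _ _) fun j _ _ => hwt j
        _ = _ := one_mul _
    · calc _ ≤ ∑ j with ¬ dom j, wt j * Z :=
            Finset.sum_le_sum fun j _ => mul_le_mul_of_nonneg_left (hall j) (hwt j)
        _ = (∑ j with ¬ dom j, wt j) * Z := by rw [Finset.sum_mul]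
        _ ≤ _ := mul_le_mul_of_nonneg_right hdom hZ.le
  have hG0 : 0 ≤ ∑ j, wt j * (√(invWidth P) * periodizedGauss (invWidth P) (x - ν j)) :=
    Finset.sum_nonneg fun j _ =>
      mul_nonneg (hwt j) (mul_nonneg (Real.sqrt_nonneg _) (periodizedGauss_nonneg _ _))
  set F := ∑ k ∈ Finset.Icc (-(P.K : ℤ)) P.K, y k * gaussWeight P k *
        Complex.exp (2 * Real.pi * Complex.I * k * x) with hF
  set G := ∑ j, wt j * (√(invWidth P) * periodizedGauss (invWidth P) (x - ν j))
  have h4 : ‖F‖ - G ≤ ‖F - (G : ℂ)‖ := by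
    have h5 := norm_sub_norm_le F (G : ℂ)
    rwa [Complex.norm_real, Real.norm_eq_abs, abs_of_nonneg hG0] at h5
  have hx' : (6 * P.β + 5 * P.ω) / 11 * Z < ‖F‖ := hx
  nlinarith

end Spectral

end Params

/-! ## The geometry of the estimates -/

theorem mem_nbhd {T : Set ℝ} {r x : ℝ} : x ∈ nbhd T r ↔ ∃ t ∈ T, |x - t| ≤ r := by
  simp only [nbhd, Set.mem_iUnion, Set.mem_Icc, exists_prop, abs_le]
  refine exists_congr fun t => and_congr_right fun _ => ?_
  constructor <;> rintro ⟨h1, h2⟩ <;> constructor <;> linarith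

theorem nbhd_mono {T : Set ℝ} {r r' : ℝ} (h : r ≤ r') : nbhd T r ⊆ nbhd T r' := fun x hx => by
  obtain ⟨t, ht, hx⟩ := mem_nbhd.mp hx
  exact mem_nbhd.mpr ⟨t, ht, hx.trans h⟩

/-- A closed discrete set plus a compact interval is closed, and there are finitely many `s`.
Closedness serves both to pass to the closure of the level set and to run the connectedness
argument. -/
theorem isClosed_setOf_exists_int {ι : Type*} [Finite ι] (lam : ι → ℝ) (Q : Set ℤ) {M : ℝ}
    (hM : M ≠ 0) (r : ℝ) : IsClosed {x : ℝ | ∃ s, ∃ q ∈ Q, |x - (lam s + q / M)| ≤ r} := by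
  have hT : IsClosed {x : ℝ | ∃ q ∈ Q, x = (q : ℝ) / M} := by
    have h1 : IsClosed ((fun q : ℤ => (q : ℝ)) '' Q) :=
      Int.isClosedEmbedding_coe_real.isClosedMap _ (isClosed_discrete Q)
    have h2 := h1.preimage (f := fun x : ℝ => x * M) (by fun_prop)
    convert h2 using 1
    ext x
    simp only [Set.mem_ofPred_eq, Set.mem_preimage, Set.mem_image]
    exact exists_congr fun q => and_congr_right fun _ => by rw [eq_div_iff hM, eq_comm]
  have h := fun s => hT.add_left_of_isCompact (isCompact_Icc (a := lam s - r) (b := lam s + r))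
  have := isClosed_iUnion_of_finite h
  convert this using 1
  ext x
  simp only [Set.mem_ofPred_eq, Set.mem_iUnion, Set.mem_add, Set.mem_Icc]
  refine exists_congr fun s => ⟨?_, ?_⟩
  · rintro ⟨q, hq, hx⟩
    rw [abs_le] at hx
    exact ⟨x - q / M, ⟨by linarith, by linarith⟩, q / M, ⟨q, hq, rfl⟩, by ring⟩
  · rintro ⟨z, ⟨h1, h2⟩, _, ⟨q, hq, rfl⟩, rfl⟩
    exact ⟨q, hq, abs_le.mpr ⟨by linarith, by linarith⟩⟩

theorem subset_fillGaps {P : Params} (h : 0 < tau P.β P.ω / P.K) (X : Set ℝ) :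
    X ⊆ fillGaps P X := fun x hx =>
  ⟨x, subset_closure hx, x, subset_closure hx, le_rfl, le_rfl, by simpa using h⟩

/-- If `X` is close to the translates of `lam` by integers, so is the set with its gaps filled. -/
theorem exists_of_mem_fillGaps {ι : Type*} [Finite ι] {lam : ι → ℝ} {P : Params} {X : Set ℝ}
    (hX : ∀ x ∈ X, ∃ s, ∃ q : ℤ, |x - (lam s + q)| < tau P.β P.ω / P.K) {x : ℝ}
    (hx : x ∈ fillGaps P X) :
    ∃ s, ∃ q : ℤ, |x - (lam s + q)| ≤ 3 / 2 * (tau P.β P.ω / P.K) := by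
  set δ := tau P.β P.ω / P.K
  have hcl : closure X ⊆ {x : ℝ | ∃ s, ∃ q ∈ (Set.univ : Set ℤ), |x - (lam s + q / 1)| ≤ δ} :=
    closure_minimal (fun z hz => by
      obtain ⟨s, q, h⟩ := hX z hz
      exact ⟨s, q, trivial, by simpa using h.le⟩)
      (isClosed_setOf_exists_int lam Set.univ one_ne_zero δ)
  obtain ⟨a, ha, b, hb, hax, hxb, hab⟩ := hx
  -- A point of a gap shorter than `δ` is within `δ / 2` of one of its ends; this is the extra half
  -- in `3 / 2`.
  have h : ∃ c ∈ closure X, |x - c| ≤ δ / 2 := by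
    rcases le_total (x - a) (δ / 2) with h | h
    · exact ⟨a, ha, by rwa [abs_of_nonneg (by linarith)]⟩
    · exact ⟨b, hb, by rw [abs_of_nonpos (by linarith)]; linarith⟩
  obtain ⟨c, hc, hxc⟩ := h
  obtain ⟨s, q, -, h⟩ := hcl hc
  rw [div_one] at h
  refine ⟨s, q, ?_⟩
  have := abs_sub_le x c (lam s + q)
  linarith

theorem mem_updateEstimate {M : ℝ} {Y E : Set ℝ} {x : ℝ} (hx : x ∈ E) (hY : M * x ∈ Y) :
    x ∈ updateEstimate M Y E :=
  ⟨x, hx, fun z hz => by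
    rw [Set.uIcc_self, Set.mem_singleton_iff] at hz
    rwa [hz]⟩

/-- The components that meet the old estimate stay close to `lam` if the nonzero translates of the
neighbourhood of `lam` do not interfere. -/
theorem updateEstimate_subset {ι : Type*} [Finite ι] {lam : ι → ℝ} {M r : ℝ} {Y E : Set ℝ}
    (hM : M ≠ 0) (hY : ∀ z, M * z ∈ Y → ∃ s, ∃ q : ℤ, |z - (lam s + q / M)| ≤ r)
    (hE : ∀ z ∈ E ∪ nbhd (Set.range lam) r, ∀ s, ∀ q : ℤ, q ≠ 0 → r < |z - (lam s + q / M)|) :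
    updateEstimate M Y E ⊆ nbhd (Set.range lam) r := by
  rintro x ⟨y, hy, hxy⟩
  have hA : nbhd (Set.range lam) r = {x : ℝ | ∃ s, ∃ q ∈ ({0} : Set ℤ), |x - (lam s + q / M)| ≤ r} := by
    ext z
    simp [mem_nbhd]
  have hAc := isClosed_setOf_exists_int lam {0} hM r
  rw [← hA] at hAc
  have hBc := isClosed_setOf_exists_int lam {q | q ≠ 0} hM r
  set B := {x : ℝ | ∃ s, ∃ q ∈ {q : ℤ | q ≠ 0}, |x - (lam s + q / M)| ≤ r}
  have hdisj : ∀ z ∈ E ∪ nbhd (Set.range lam) r, z ∉ B := by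
    rintro z hz ⟨s, q, hq, h⟩
    exact absurd h (not_le.mpr (hE z hz s q hq))
  have hcov : Set.uIcc x y ⊆ nbhd (Set.range lam) r ∪ B := by
    intro z hz
    obtain ⟨s, q, h⟩ := hY z (hxy z hz)
    by_cases hq : q = 0
    · left
      rw [hA]
      exact ⟨s, q, hq, h⟩
    · exact Or.inr ⟨s, q, hq, h⟩
  by_contra hx
  -- The segment is covered by the closed neighbourhood of the true eigenvalues and the closed
  -- neighbourhood `B` of their aliases. One end is in the first set; if the other were in `B`,
  -- connectedness would give a common point, which `hE` excludes.
  obtain ⟨z, -, hz1, hz2⟩ := isPreconnected_closed_iff.mp isPreconnected_uIcc _ _ hAc hBc hcov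
    ⟨y, Set.right_mem_uIcc, (hcov Set.right_mem_uIcc).resolve_right (hdisj y (Or.inl hy))⟩
    ⟨x, Set.left_mem_uIcc, (hcov Set.left_mem_uIcc).resolve_left hx⟩
  exact hdisj z (Or.inr hz1) hz2

/-! ## Existence of a separating factor -/

theorem etaChoice_pos {S : ℕ} (hS : 1 ≤ S) : 0 < etaChoice S := by
  have : (1 : ℝ) ≤ S := by exact_mod_cast hS
  have h2 : 0 < 2 * (S : ℝ) - 1 := by linarith
  unfold etaChoice
  positivity

theorem etaChoice_mul {S : ℕ} (hS : 1 ≤ S) : etaChoice S * (8 * S * (2 * S - 1)) = 1 := by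
  have : (1 : ℝ) ≤ S := by exact_mod_cast hS
  have h2 : 0 < 2 * (S : ℝ) - 1 := by linarith
  rw [etaChoice, one_div, inv_mul_cancel₀ (by positivity)]

theorem etaChoice_le {S : ℕ} (hS : 1 ≤ S) : etaChoice S ≤ 1 / 8 := by
  have h1 : (1 : ℝ) ≤ S := by exact_mod_cast hS
  have h := etaChoice_mul hS
  have h0 := etaChoice_pos hS
  nlinarith [mul_nonneg h0.le (mul_nonneg (sub_nonneg.mpr h1) (by linarith : (0 : ℝ) ≤ 2 * S + 1))]

theorem etaChoice_le_of_two_le {S : ℕ} (hS : 2 ≤ S) : etaChoice S ≤ 1 / 48 := by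
  have h1 : (2 : ℝ) ≤ S := by exact_mod_cast hS
  have h := etaChoice_mul (by omega : 1 ≤ S)
  have h0 := etaChoice_pos (by omega : 1 ≤ S)
  nlinarith [mul_nonneg h0.le (mul_nonneg (sub_nonneg.mpr h1) (by linarith : (0 : ℝ) ≤ 2 * S + 3))]

/-- For `A ≥ 1` there are at most `A + 8 h + 1` terms, each at most `1 / A`. For `A < 1` only `1`
and `2` can occur. The bound is uniform in `A`, hence in the distance between two eigenvalues. -/
theorem sum_inv_Icc_le {A h : ℝ} (h0 : 0 ≤ h) (h1 : h ≤ 1 / 24) :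
    ∑ q ∈ Finset.Icc (max 1 ⌈A⌉₊) ⌊2 * A + 8 * h⌋₊, ((q : ℝ))⁻¹ ≤ 2 + 8 * h := by
  rcases le_or_gt 1 A with hA | hA
  · have hc : 1 ≤ ⌈A⌉₊ := Nat.one_le_ceil_iff.mpr (by linarith)
    rw [max_eq_right hc]
    calc _ ≤ ∑ q ∈ Finset.Icc ⌈A⌉₊ ⌊2 * A + 8 * h⌋₊, A⁻¹ := by
          refine Finset.sum_le_sum fun q hq => ?_
          gcongr
          exact Nat.ceil_le.mp (Finset.mem_Icc.mp hq).1
      _ = (⌊2 * A + 8 * h⌋₊ + 1 - ⌈A⌉₊ : ℕ) * A⁻¹ := by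
          rw [Finset.sum_const, Nat.card_Icc, nsmul_eq_mul]
      _ ≤ (A + 8 * h + 1) * A⁻¹ := by
          refine mul_le_mul_of_nonneg_right ?_ (by positivity)
          have h2 := Nat.floor_le (by linarith : 0 ≤ 2 * A + 8 * h)
          have h3 := Nat.le_ceil A
          rcases le_total ⌈A⌉₊ (⌊2 * A + 8 * h⌋₊ + 1) with h4 | h4
          · rw [Nat.cast_sub h4]
            push_cast
            linarith
          · rw [Nat.sub_eq_zero_of_le h4]
            push_cast
            linarith
      _ ≤ 2 + 8 * h := by
          rw [← div_eq_mul_inv, div_le_iff₀ (by linarith)]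
          nlinarith
  · have hB : ⌊2 * A + 8 * h⌋₊ ≤ 2 := by
      have : ⌊2 * A + 8 * h⌋₊ < 3 := by
        rw [Nat.floor_lt' (by norm_num)]
        push_cast
        linarith
      omega
    calc _ ≤ ∑ q ∈ Finset.Icc 1 2, ((q : ℕ) : ℝ)⁻¹ :=
          Finset.sum_le_sum_of_subset_of_nonneg
            (Finset.Icc_subset_Icc (le_max_left _ _) hB) fun q _ _ => by positivity
      _ = 3 / 2 := by
          rw [show Finset.Icc 1 2 = {1, 2} from rfl, Finset.sum_pair (by norm_num)]
          norm_num
      _ ≤ _ := by linarith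

/-- The reciprocals of the factors for which a distance `d` is close to a multiple of the period. -/
def resonantSet (d h : ℝ) : Set ℝ :=
  {u | u ∈ Set.Ioo (1 / 4 : ℝ) (1 / 2) ∧ ∃ q : ℕ, 1 ≤ q ∧ |d - q * u| ≤ h}

/-- Each `q` excludes an interval of length `2 h / q`, and `1/4 < u < 1/2` forces `2 (d - h) ≤ q ≤ 4
(d + h)`. Over such a window the reciprocals have a bounded sum. -/
theorem volume_resonantSet_le {d h : ℝ} (h0 : 0 ≤ h) (h1 : h ≤ 1 / 24) :
    MeasureTheory.volume (resonantSet d h) ≤ ENNReal.ofReal (2 * h * (2 + 8 * h)) := by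
  set A := 2 * (d - h) with hA
  set Q := Finset.Icc (max 1 ⌈A⌉₊) ⌊2 * A + 8 * h⌋₊ with hQ
  have hsub : resonantSet d h ⊆ ⋃ q ∈ Q, Set.Icc ((d - h) / (q : ℝ)) ((d + h) / q) := by
    rintro u ⟨⟨hu1, hu2⟩, q, hq, hd⟩
    have hq' : (1 : ℝ) ≤ q := by exact_mod_cast hq
    rw [abs_le] at hd
    simp only [Set.mem_iUnion, Set.mem_Icc, exists_prop]
    refine ⟨q, ?_, ?_, ?_⟩
    · rw [hQ, Finset.mem_Icc, max_le_iff, Nat.ceil_le]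
      exact ⟨⟨hq, by nlinarith⟩, Nat.le_floor (by nlinarith)⟩
    · rw [div_le_iff₀ (by linarith)]
      linarith
    · rw [le_div_iff₀ (by linarith)]
      linarith
  calc _ ≤ ∑ q ∈ Q, MeasureTheory.volume (Set.Icc ((d - h) / (q : ℝ)) ((d + h) / q)) :=
        (MeasureTheory.measure_mono hsub).trans (MeasureTheory.measure_biUnion_finset_le _ _)
    _ = ∑ q ∈ Q, ENNReal.ofReal (2 * h * (q : ℝ)⁻¹) := by
        refine Finset.sum_congr rfl fun q _ => ?_
        rw [Real.volume_Icc]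
        congr 1
        ring
    _ = ENNReal.ofReal (2 * h * ∑ q ∈ Q, (q : ℝ)⁻¹) := by
        rw [Finset.mul_sum, ENNReal.ofReal_sum_of_nonneg fun q _ => by positivity]
    _ ≤ _ := by
        apply ENNReal.ofReal_le_ofReal
        gcongr
        exact sum_inv_Icc_le h0 h1

theorem exists_nonresonant {S : ℕ} (hS : 1 ≤ S) (x : Fin S → ℝ) :
    ∃ u ∈ Set.Ioo (1 / 4 : ℝ) (1 / 2), ∀ s t, ∀ q : ℤ, q ≠ 0 →
      2 * etaChoice S < |x s - x t - q * u| := by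
  have hη := etaChoice_pos hS
  set h := 2 * etaChoice S with hh
  set pairs : Finset (Fin S × Fin S) := Finset.univ.filter fun p => p.1 < p.2 with hpairs
  have hcard : 2 * (pairs.card : ℝ) = S * (S - 1) := by
    have h1 : pairs.card = ∑ t : Fin S, (t : ℕ) := by
      rw [hpairs, Finset.card_filter, Fintype.sum_prod_type_right]
      refine Finset.sum_congr rfl fun t _ => ?_
      rw [← Finset.card_filter, Finset.filter_gt_eq_Iio, Fin.card_Iio]
    have h2 := Finset.sum_range_id_mul_two S
    rw [← Fin.sum_univ_eq_sum_range (fun i => i), ← h1] at h2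
    rw [← Nat.cast_pred hS, mul_comm (2 : ℝ)]
    exact_mod_cast h2
  have hex : ∃ u ∈ Set.Ioo (1 / 4 : ℝ) (1 / 2), ∀ p ∈ pairs, u ∉ resonantSet |x p.1 - x p.2| h := by
    by_contra! hcon
    have hsub : Set.Ioo (1 / 4 : ℝ) (1 / 2) ⊆ ⋃ p ∈ pairs, resonantSet |x p.1 - x p.2| h := by
      intro u hu
      obtain ⟨p, hp, hup⟩ := hcon u hu
      exact Set.mem_biUnion hp hup
    rcases Nat.lt_or_ge S 2 with hS2 | hS2
    · obtain ⟨p, hp, -⟩ := hcon (1 / 3) (by norm_num)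
      have := (Finset.mem_filter.mp hp).2
      omega
    have h48 := etaChoice_le_of_two_le hS2
    have hvol := (MeasureTheory.measure_mono hsub).trans
      ((MeasureTheory.measure_biUnion_finset_le (μ := MeasureTheory.volume) _ _).trans
        (Finset.sum_le_sum fun p _ => volume_resonantSet_le
          (d := |x p.1 - x p.2|) (h := h) (by positivity) (by linarith)))
    rw [Real.volume_Ioo, Finset.sum_const, nsmul_eq_mul, ← ENNReal.ofReal_natCast,
      ← ENNReal.ofReal_mul (by positivity), ENNReal.ofReal_le_ofReal_iff (by positivity)] at hvol
    have h1 := etaChoice_mul hS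
    have hS1 : (2 : ℝ) ≤ S := by exact_mod_cast hS2
    have h3 : 1 / 2 ≤ (S * ((S : ℝ) - 1)) * (2 * h * (2 + 8 * h)) := by rw [← hcard]; linarith
    have h4 : etaChoice S * (16 * (S - 1)) < 1 := by
      rw [← h1]
      apply mul_lt_mul_of_pos_left _ hη
      nlinarith
    -- This identity explains the value of `η`: the total excluded measure, doubled and multiplied
    -- by `2 S - 1`, equals `(S - 1) (1 + 8 η)`. By `h4` that is less than `S - 1 / 2`, so the
    -- excluded sets have total measure below `1 / 4`.
    have h5 : (S * ((S : ℝ) - 1)) * (2 * h * (2 + 8 * h)) * (2 * S - 1) =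
        (etaChoice S * (8 * S * (2 * S - 1))) * ((S - 1) + etaChoice S * (16 * (S - 1)) / 2) := by
      rw [hh]; ring
    rw [h1] at h5
    nlinarith
  obtain ⟨u, hu, hgood⟩ := hex
  refine ⟨u, hu, ?_⟩
  have hlt : ∀ s t, s < t → ∀ q : ℤ, q ≠ 0 → h < |(|x s - x t|) - |(q : ℝ)| * u| := by
    intro s t hst q hq
    by_contra! hle
    refine hgood (s, t) (by simpa [hpairs] using hst) ⟨hu, q.natAbs, by omega, ?_⟩
    simpa [Nat.cast_natAbs] using hle
  intro s t q hq
  have hrev : |(|x s - x t|) - |(q : ℝ)| * u| ≤ |x s - x t - q * u| := by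
    have := abs_abs_sub_abs_le_abs_sub (x s - x t) (q * u)
    rwa [abs_mul, abs_of_pos (by linarith [hu.1] : 0 < u)] at this
  refine lt_of_lt_of_le ?_ hrev
  rcases lt_trichotomy s t with hst | rfl | hst
  · exact hlt s t hst q hq
  -- For equal indices no exclusion is needed, since `u > 1 / 4 ≥ 2 η`. Strictness of `u > 1 / 4`
  -- matters for `S = 1`, where `2 η = 1 / 4`.
  · have h1 : (1 : ℝ) ≤ |(q : ℝ)| := by exact_mod_cast Int.one_le_abs hq
    have h2 := etaChoice_le hS
    rw [sub_self, abs_zero, zero_sub, abs_neg, abs_mul, abs_abs,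
      abs_of_pos (by linarith [hu.1] : 0 < u)]
    nlinarith [hu.1]
  · rw [abs_sub_comm (x s) (x t)]
    exact hlt t s hst q hq

/-- After rescaling by `M`, take `m = 1 / u` with `u` nonresonant. Each of two points in the
neighbourhood of `E` is within `η / M` of some eigenvalue, so a coincidence after translation would
bring a difference of eigenvalues within `2 η / M` of a nonzero period. -/
theorem exists_separates {S : ℕ} (hS : 1 ≤ S) (lam : Fin S → ℝ) {M : ℝ} (hM : 0 < M) {E : Set ℝ}
    (hE : E ⊆ nbhd (Set.range lam) (etaChoice S / (2 * M))) :
    ∃ m ∈ Set.Icc (2 : ℝ) 4, Separates (nbhd E (etaChoice S / (2 * M))) M m := by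
  obtain ⟨u, ⟨hu1, hu2⟩, hu⟩ := exists_nonresonant hS fun s => M * lam s
  have hu0 : 0 < u := by linarith
  refine ⟨u⁻¹, ⟨?_, ?_⟩, fun q hq => ?_⟩
  · rw [le_inv_comm₀ (by norm_num) hu0]; linarith
  · rw [inv_le_comm₀ hu0 (by norm_num)]; linarith
  rw [Set.disjoint_left]
  rintro _ ⟨z, hz, rfl⟩ hz'
  obtain ⟨e, he, hze⟩ := mem_nbhd.mp hz
  obtain ⟨e', he', hze'⟩ := mem_nbhd.mp hz'
  obtain ⟨_, ⟨s, rfl⟩, hs⟩ := mem_nbhd.mp (hE he)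
  obtain ⟨_, ⟨t, rfl⟩, ht⟩ := mem_nbhd.mp (hE he')
  have h1 := hu t s q hq
  have h2 : M * lam t - M * lam s - q * u = M * (lam t - lam s - q / (M * u⁻¹)) := by
    field_simp
  rw [h2, abs_mul, abs_of_pos hM] at h1
  simp only at hze'
  set R := etaChoice S / (2 * M) with hR
  have h3 : 2 * etaChoice S = M * (4 * R) := by rw [hR]; field_simp; ring
  rw [h3] at h1
  have h4 := lt_of_mul_lt_mul_left h1 hM.le
  have h5 : |lam t - lam s - q / (M * u⁻¹)| ≤ 4 * R := by
    rw [abs_le] at *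
    constructor <;> linarith [hze.1, hze.2]
  linarith

/-- A point near an alias `lam s + q / (M m)` shifts back into the neighbourhood of `E`, because
`lam s ∈ E` and the new radius is at most the old one. If the point also lies in that neighbourhood,
it contradicts separation. -/
theorem updateEstimate_subset_of_separates {ι : Type*} [Finite ι] {lam : ι → ℝ} {M m η : ℝ}
    {Y E : Set ℝ} (hM : 0 < M) (hm : 1 ≤ m) (hη : 0 ≤ η) (hΛ : Set.range lam ⊆ E)
    (hsep : Separates (nbhd E (η / (2 * M))) M m)
    (hY : ∀ z, M * m * z ∈ Y → ∃ s, ∃ q : ℤ, |z - (lam s + q / (M * m))| ≤ η / (2 * (M * m))) :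
    updateEstimate (M * m) Y E ⊆ nbhd (Set.range lam) (η / (2 * (M * m))) := by
  have hr : η / (2 * (M * m)) ≤ η / (2 * M) := by
    gcongr
    nlinarith
  refine updateEstimate_subset (by positivity) hY fun z hz s q hq => ?_
  by_contra! hle
  refine Set.disjoint_left.mp (hsep q hq) ⟨z - q / (M * m), ?_, by simp⟩ (?_ : z ∈ _)
  · exact mem_nbhd.mpr ⟨lam s, hΛ ⟨s, rfl⟩, by rw [sub_sub, add_comm]; exact hle.trans hr⟩
  · rcases hz with hz | hz
    · exact mem_nbhd.mpr ⟨z, hz, by simpa using by positivity⟩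
    · obtain ⟨_, ⟨t, rfl⟩, h⟩ := mem_nbhd.mp hz
      exact mem_nbhd.mpr ⟨lam t, hΛ ⟨t, rfl⟩, h.trans hr⟩

theorem updateEstimate_subset_of_Icc {S : ℕ} (hS : 1 ≤ S) {lam : Fin S → ℝ}
    (hlam : ∀ s, lam s ∈ Set.Icc (0 : ℝ) (9 / 10)) {Y : Set ℝ}
    (hY : ∀ z, 1 * z ∈ Y → ∃ s, ∃ q : ℤ, |z - (lam s + q / 1)| ≤ etaChoice S / (2 * 1)) :
    updateEstimate 1 Y (Set.Icc 0 (9 / 10)) ⊆ nbhd (Set.range lam) (etaChoice S / (2 * 1)) := by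
  refine updateEstimate_subset one_ne_zero hY fun z hz s q hq => ?_
  have h1 : (1 : ℝ) ≤ |(q : ℝ)| := by exact_mod_cast Int.one_le_abs hq
  have hη := etaChoice_le hS
  have hη0 := etaChoice_pos hS
  have key : |(q : ℝ)| - |z - lam s| ≤ |z - (lam s + q / 1)| := by
    have := abs_sub_abs_le_abs_sub (q : ℝ) (z - lam s)
    rwa [abs_sub_comm (q : ℝ), sub_sub, show lam s + q = lam s + q / 1 by ring] at this
  rcases hz with hz | hz
  · have : |z - lam s| ≤ 9 / 10 :=
      abs_le.mpr ⟨by linarith [hz.1, (hlam s).2], by linarith [hz.2, (hlam s).1]⟩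
    linarith
  · obtain ⟨_, ⟨t, rfl⟩, h⟩ := mem_nbhd.mp hz
    -- The range `[0, 0.9]` leaves a margin `0.1` to the nearest alias, which requires `η < 0.1`.
    -- This fails for `S = 1`, but then there is a single eigenvalue and the margin is `1`.
    rcases Nat.lt_or_ge S 2 with hS2 | hS2
    · have : t = s := by
        obtain rfl : S = 1 := by omega
        exact Subsingleton.elim _ _
      subst this
      linarith
    · have h48 := etaChoice_le_of_two_le hS2
      have : |lam t - lam s| ≤ 9 / 10 :=
        abs_le.mpr ⟨by linarith [(hlam t).1, (hlam s).2], by linarith [(hlam t).2, (hlam s).1]⟩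
      have := abs_sub_le z (lam t) (lam s)
      linarith

/-! ## Spectral decomposition of the signal -/

/-- The exponential series is compared term by term. It is used both for evaluation at an
eigenvector and for pairing with one. -/
theorem map_exp_eq_exp_smul {R F : Type*} [NormedRing R] [NormedAlgebra ℂ R] [CompleteSpace R]
    [NormedAddCommGroup F] [NormedSpace ℂ F] (L : R →L[ℂ] F) {A : R} {z : ℂ}
    (h : ∀ n : ℕ, L (A ^ n) = z ^ n • L 1) : L (NormedSpace.exp A) = Complex.exp z • L 1 := by
  have h1 := (NormedSpace.exp_series_hasSum_exp' (𝕂 := ℂ) A).mapL L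
  have h2 := (NormedSpace.exp_series_hasSum_exp' (𝕂 := ℂ) z).smul_const (L 1)
  rw [← Complex.exp_eq_exp_ℂ] at h2
  refine h1.unique (h2.congr_fun fun n => ?_)
  rw [map_smul, h, smul_smul, smul_eq_mul]

section Quantum

variable {V : Type*} [NormedAddCommGroup V] [InnerProductSpace ℂ V] [CompleteSpace V]

theorem QuantumInput.evolution_apply_eigenvector (Q : QuantumInput V) {v : V} {μ : ℝ}
    (hv : Q.H v = (μ : ℂ) • v) (t : ℝ) :
    Q.evolution t v = Complex.exp (-(2 * Real.pi * Complex.I * t * μ)) • v := by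
  have h := map_exp_eq_exp_smul (ContinuousLinearMap.apply ℂ V v)
    (A := (-(2 * Real.pi * t) * Complex.I : ℂ) • Q.H)
    (z := -(2 * Real.pi * Complex.I * t * μ)) (fun n => by
      induction n with
      | zero => simp
      | succ n ih =>
        rw [pow_succ, pow_succ]
        simp only [ContinuousLinearMap.apply_apply, mul_apply_eq_comp,
          one_apply_eq_self, _root_.smul_apply, hv, map_smul] at ih ⊢
        rw [ih]
        simp only [smul_smul]
        congr 1
        ring)
  simpa [QuantumInput.evolution] using h

theorem QuantumInput.inner_eigenvector_evolution (Q : QuantumInput V) {v : V} {μ : ℝ}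
    (hv : Q.H v = (μ : ℂ) • v) (t : ℝ) (x : V) :
    inner ℂ v (Q.evolution t x) =
      Complex.exp (-(2 * Real.pi * Complex.I * t * μ)) * inner ℂ v x := by
  have hH : ∀ y, inner ℂ v (Q.H y) = (μ : ℂ) * inner ℂ v y := fun y => by
    have hs := ContinuousLinearMap.isSelfAdjoint_iff_isSymmetric.mp Q.isSelfAdjoint_H
    rw [← ContinuousLinearMap.coe_coe, ← hs v y, ContinuousLinearMap.coe_coe, hv, inner_smul_left,
      Complex.conj_ofReal]
  have h := map_exp_eq_exp_smul ((innerSL ℂ v).comp (ContinuousLinearMap.apply ℂ V x))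
    (A := (-(2 * Real.pi * t) * Complex.I : ℂ) • Q.H)
    (z := -(2 * Real.pi * Complex.I * t * μ)) (fun n => by
      induction n with
      | zero => simp
      | succ n ih =>
        rw [pow_succ', pow_succ']
        simp only [ContinuousLinearMap.comp_apply, ContinuousLinearMap.apply_apply,
          mul_apply_eq_comp, innerSL_apply_apply,
          one_apply_eq_self, _root_.smul_apply, inner_smul_right, hH, smul_eq_mul]
          at ih ⊢
        rw [ih]
        ring)
  simpa [QuantumInput.evolution] using h

/-- The signal is the Fourier transform of a probability distribution on the line that has mass at
least `β` at each dominant eigenvalue and mass at most `ω` outside of them. -/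
theorem HasDominantEigenvalues.exists_weights [FiniteDimensional ℂ V] {Q : QuantumInput V} {S : ℕ}
    {lam : Fin S → ℝ} {β ω : ℝ} (h : HasDominantEigenvalues Q S lam β ω) :
    ∃ (n : ℕ) (wt μ : Fin S ⊕ Fin n → ℝ), (∀ j, 0 ≤ wt j) ∧ ∑ j, wt j = 1 ∧
      (∀ s, β ≤ wt (Sum.inl s)) ∧ (∀ s, μ (Sum.inl s) = lam s) ∧ ∑ j, wt (Sum.inr j) ≤ ω ∧
      ∀ t, inner ℂ Q.psi (Q.evolution t Q.psi) =
        ∑ j, (wt j : ℂ) * Complex.exp (-(2 * Real.pi * Complex.I * t * μ j)) := by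
  obtain ⟨φ, c, r, hφ, hH, hpsi, hr, hc, hω⟩ := h
  have hs := ContinuousLinearMap.isSelfAdjoint_iff_isSymmetric.mp Q.isSelfAdjoint_H
  -- Only the residual is expanded in this eigenbasis. It need not extend `φ`, and its eigenvalues
  -- may repeat dominant ones.
  set b := hs.eigenvectorBasis rfl with hb
  set e := hs.eigenvalues rfl with he
  have hbe : ∀ j, Q.H (b j) = (e j : ℂ) • b j := fun j => hs.apply_eigenvectorBasis rfl j
  have hform : ∀ t, inner ℂ Q.psi (Q.evolution t Q.psi) =
      ∑ j, ((Sum.elim (fun s => ‖c s‖ ^ 2) (fun j => ‖inner ℂ (b j) r‖ ^ 2) j : ℝ) : ℂ) *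
        Complex.exp (-(2 * Real.pi * Complex.I * t * (Sum.elim lam e j : ℝ))) := by
    intro t
    have h1 : ∀ s, inner ℂ (φ s) Q.psi = c s := fun s => by
      rw [hpsi, inner_add_right, hr, add_zero, hφ.inner_right_fintype]
    have h2 : ∀ s, inner ℂ r (φ s) = 0 := fun s => by
      rw [← inner_conj_symm, hr, map_zero]
    have h3 : inner ℂ r (Q.evolution t Q.psi) = inner ℂ r (Q.evolution t r) := by
      nth_rw 1 [hpsi]
      rw [map_add, map_sum, inner_add_right, inner_sum, Finset.sum_eq_zero, zero_add]
      intro s _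
      rw [map_smul, Q.evolution_apply_eigenvector (hH s), inner_smul_right, inner_smul_right, h2]
      simp
    nth_rw 1 [hpsi]
    rw [inner_add_left, sum_inner, h3, ← b.sum_inner_mul_inner, Fintype.sum_sum_type]
    simp only [Sum.elim_inl, Sum.elim_inr]
    congr 1
    · refine Finset.sum_congr rfl fun s _ => ?_
      rw [inner_smul_left, Q.inner_eigenvector_evolution (hH s), h1, Complex.ofReal_pow,
        ← Complex.conj_mul']
      ring
    · refine Finset.sum_congr rfl fun j _ => ?_
      rw [Q.inner_eigenvector_evolution (hbe j), Complex.ofReal_pow, ← Complex.conj_mul',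
        inner_conj_symm]
      ring
  refine ⟨_, _, _, ?_, ?_, fun s => hc s, fun s => rfl, ?_, hform⟩
  · rintro (s | j)
    · exact sq_nonneg _
    · exact sq_nonneg _
  -- The total mass is the signal at time `0`, that is `‖ψ‖ ^ 2`.
  · have h0 := hform 0
    have h1 : Q.evolution 0 Q.psi = Q.psi := by simp [QuantumInput.evolution]
    rw [h1, inner_self_eq_norm_sq_to_K, Q.norm_psi] at h0
    simp only [Complex.ofReal_zero, mul_zero, zero_mul, neg_zero, Complex.exp_zero, mul_one] at h0
    rw [← Complex.ofReal_sum] at h0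
    simpa using (Complex.ofReal_injective (h0.symm.trans (Complex.ofReal_pow 1 2).symm))
  · simp only [Sum.elim_inr]
    rw [b.sum_sq_norm_inner_right]
    exact hω

omit [CompleteSpace V] in
theorem hadamardGate_norm_sub (v : Fin 2 → V) :
    ‖hadamardGate v 0‖ ^ 2 - ‖hadamardGate v 1‖ ^ 2 = 2 * (inner ℂ (v 0) (v 1)).re := by
  have h2 : ‖(((1 / √2 : ℝ)) : ℂ)‖ ^ 2 = 1 / 2 := by
    rw [Complex.norm_real, Real.norm_eq_abs, sq_abs, div_pow, Real.sq_sqrt (by norm_num)]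
    norm_num
  have h3 := norm_add_sq (𝕜 := ℂ) (v 0) (v 1)
  have h4 := norm_sub_sq (𝕜 := ℂ) (v 0) (v 1)
  simp only [RCLike.re_to_complex] at h3 h4
  simp only [hadamardGate, Matrix.cons_val_zero, Matrix.cons_val_one, norm_smul, mul_pow, h2]
  rw [h3, h4]
  ring

theorem QuantumInput.measure_sub (Q : QuantumInput V) (t : ℝ) (im : Bool) :
    (Q.measure t im 0).toReal - (Q.measure t im 1).toReal =
      if im then (inner ℂ Q.psi (Q.evolution t Q.psi)).im
      else (inner ℂ Q.psi (Q.evolution t Q.psi)).re := by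
  simp only [QuantumInput.measure, PMF.ofFintype_apply]
  rw [ENNReal.toReal_ofReal (by positivity), ENNReal.toReal_ofReal (by positivity),
    hadamardTestState]
  simp only [hadamardGate_norm_sub]
  have hs : (1 / √2 : ℝ) * (1 / √2) = 1 / 2 := by
    rw [div_mul_div_comm, Real.mul_self_sqrt (by norm_num), one_mul]
  cases im
  · simp only [controlledGate, hadamardGate, Matrix.cons_val_zero, Matrix.cons_val_one, add_zero,
      sub_zero, map_smul, inner_smul_left, inner_smul_right, Bool.false_eq_true, if_false,
      Complex.conj_ofReal]
    rw [← mul_assoc, ← Complex.ofReal_mul, hs, Complex.re_ofReal_mul]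
    ring
  · simp only [controlledGate, hadamardGate, phaseDaggerGate, Matrix.cons_val_zero,
      Matrix.cons_val_one, add_zero, sub_zero, map_smul, inner_smul_left, inner_smul_right, if_true,
      Complex.conj_ofReal]
    rw [mul_left_comm, mul_left_comm _ (-Complex.I), ← mul_assoc, ← mul_assoc, mul_assoc (-Complex.I),
      ← Complex.ofReal_mul, hs]
    simp

end Quantum

/-! ## Concentration for independent finite sampling -/

/-- Identifies the joint law with a product measure, whose coordinates are independent. -/
theorem toMeasure_piPMF {ι : Type} [Fintype ι] [DecidableEq ι] (p : ι → PMF (Fin 2)) :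
    (piPMF p).toMeasure = MeasureTheory.Measure.pi fun i => (p i).toMeasure := by
  refine MeasureTheory.Measure.ext_of_singleton fun f => ?_
  rw [MeasureTheory.Measure.pi_singleton, PMF.toMeasure_apply_singleton _ _ (measurableSet_singleton _)]
  simp only [piPMF, PMF.ofFintype_apply]
  refine Finset.prod_congr rfl fun i _ => ?_
  rw [PMF.toMeasure_apply_singleton _ _ (measurableSet_singleton _)]

theorem integral_sign_toMeasure (p : PMF (Fin 2)) :
    ∫ x, (if x = 0 then (1 : ℝ) else -1) ∂p.toMeasure = (p 0).toReal - (p 1).toReal := by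
  rw [PMF.integral_eq_sum]
  simp
  ring

/-- Hoeffding's inequality for independent signs with a common mean. -/
theorem piPMF_hoeffding {ι J : Type} [Fintype ι] [DecidableEq ι] [Fintype J] (p : ι → PMF (Fin 2))
    (f : J → ι) (hf : f.Injective) {m : ℝ}
    (hm : ∀ j, (p (f j) 0).toReal - (p (f j) 1).toReal = m) {t : ℝ} (ht : 0 ≤ t) :
    (piPMF p).toOuterMeasure
      {o | t * Fintype.card J < |∑ j, (if o (f j) = 0 then (1 : ℝ) else -1) - Fintype.card J * m|} ≤
      ENNReal.ofReal (2 * Real.exp (-(Fintype.card J * t ^ 2 / 2))) := by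
  set n : ℝ := (Fintype.card J : ℝ) with hn
  set X : Fin 2 → ℝ := fun x => if x = 0 then 1 else -1 with hX
  set ν := MeasureTheory.Measure.pi fun i => (p i).toMeasure with hν
  set mean : ι → ℝ := fun i => (p i 0).toReal - (p i 1).toReal with hmean
  have hint : ∀ i, ∫ x, X x ∂(p i).toMeasure = mean i := fun i => integral_sign_toMeasure _
  set Z : ι → (ι → Fin 2) → ℝ := fun i o => X (o i) - mean i with hZ
  have hind : ProbabilityTheory.iIndepFun Z ν :=
    ProbabilityTheory.iIndepFun_pi (X := fun i x => X x - mean i)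
      fun i => (measurable_of_finite _).aemeasurable
  have hind' : ProbabilityTheory.iIndepFun (fun i o => -Z i o) ν :=
    ProbabilityTheory.iIndepFun_pi (X := fun i x => -(X x - mean i))
      fun i => (measurable_of_finite _).aemeasurable
  have hsub : ∀ i, ProbabilityTheory.HasSubgaussianMGF (Z i) 1 ν := by
    intro i
    have hmi : ∫ o, X (o i) ∂ν = mean i := by
      rw [← hint i]
      have := MeasureTheory.measurePreserving_eval (fun i => (p i).toMeasure) i
      rw [← this.map_eq, MeasureTheory.integral_map (measurable_pi_apply i).aemeasurable
        (measurable_of_finite _).aestronglyMeasurable]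
    -- Values in `[-1, 1]` give the sub-Gaussian parameter `((1 - (-1)) / 2) ^ 2 = 1`.
    have h := ProbabilityTheory.hasSubgaussianMGF_of_mem_Icc (μ := ν) (X := fun o => X (o i))
      (a := -1) (b := 1) (measurable_of_finite _).aemeasurable
      (Filter.Eventually.of_forall fun o => by
        simp only [hX]; split_ifs <;> norm_num)
    rw [hmi] at h
    convert h using 1
    ext
    norm_num
  set s : Finset ι := Finset.univ.map ⟨f, hf⟩ with hs
  have hsum : ∀ g : ι → ℝ, ∑ i ∈ s, g i = ∑ j, g (f j) := fun g => by
    rw [hs, Finset.sum_map]; rfl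
  have hcard : (s.card : ℝ) = n := by rw [hs, Finset.card_map, Finset.card_univ]
  have hexp : Real.exp (-(t * n) ^ 2 / (2 * ((∑ i ∈ s, 1 : NNReal) : ℝ))) =
      Real.exp (-(n * t ^ 2 / 2)) := by
    congr 1
    rw [Finset.sum_const, nsmul_eq_mul, mul_one, NNReal.coe_natCast, hcard]
    rcases eq_or_ne n 0 with h0 | h0
    · rw [h0]; simp
    · field_simp
  have htn : 0 ≤ t * n := by positivity
  have h1 := ProbabilityTheory.HasSubgaussianMGF.measure_sum_ge_le_of_iIndepFun hind (s := s)
    (fun i _ => hsub i) htn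
  have h2 := ProbabilityTheory.HasSubgaussianMGF.measure_sum_ge_le_of_iIndepFun hind' (s := s)
    (fun i _ => (hsub i).neg) htn
  rw [hexp] at h1 h2
  rw [← PMF.toMeasure_apply_eq_toOuterMeasure, toMeasure_piPMF, ← hν,
    ← MeasureTheory.ofReal_measureReal]
  apply ENNReal.ofReal_le_ofReal
  refine (MeasureTheory.measureReal_mono ?_).trans
    ((MeasureTheory.measureReal_union_le _ _).trans ((add_le_add h1 h2).trans_eq (by ring)))
  intro o ho
  have e : ∑ i ∈ s, Z i o = ∑ j, X (o (f j)) - n * m := by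
    rw [hsum]
    simp only [hZ, hmean, hm, Finset.sum_sub_distrib, Finset.sum_const, Finset.card_univ,
      nsmul_eq_mul, hn]
  rw [Set.mem_union, Set.mem_ofPred_eq, Set.mem_ofPred_eq, Finset.sum_neg_distrib, e]
  rcases lt_abs.mp (Set.mem_ofPred_eq.mp ho) with h | h
  · exact Or.inl h.le
  · exact Or.inr h.le

/-! ## One pass of the loop -/

section Pass

variable {V : Type*} [NormedAddCommGroup V] [InnerProductSpace ℂ V] [CompleteSpace V]

/-- The average of the estimates of `⟨ψ, U ^ (M k) ψ⟩` is accurate for all `k`. -/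
def IsAccurate (Q : QuantumInput V) (P : Params) (M : ℝ) (o : Circuit P → Fin 2) : Prop :=
  ∀ k : Fin (P.K + 1), ‖(average P o k false + average P o k true * Complex.I : ℂ) -
    inner ℂ Q.psi (Q.evolution (M * (k : ℕ)) Q.psi)‖ ≤ P.α

/-- The number of iterations after which the loop has ended. -/
def passBound (P : Params) : ℕ := ⌈Real.logb 2 (P.η / P.ε)⌉₊ + 1

theorem passBound_cast {P : Params} (hε : 0 < P.ε) (hεη : P.ε < P.η) :
    ((⌈Real.logb 2 (P.η / P.ε)⌉ : ℝ) + 1) = passBound P := by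
  have h : 0 ≤ Real.logb 2 (P.η / P.ε) :=
    Real.logb_nonneg (by norm_num) ((one_le_div hε).mpr hεη.le)
  have h2 := natCast_ceil_eq_intCast_ceil h (R := ℝ)
  rw [passBound]
  push_cast
  rw [h2]

theorem mul_sq_halfShots_ge {P : Params} (hα : 0 < P.α) (hε : 0 < P.ε) (hεη : P.ε < P.η) :
    Real.log (4 / P.ρ) + Real.log (passBound P) + Real.log ((P.K : ℝ) + 1) ≤
      P.halfShots * P.α ^ 2 / 4 := by
  have h : _ ≤ (P.halfShots : ℝ) := Nat.le_ceil _
  rw [passBound_cast hε hεη, div_mul_eq_mul_div, div_le_iff₀ (by positivity)] at h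
  linarith

theorem halfShots_pos {P : Params} (hα : 0 < P.α) (hε : 0 < P.ε) (hεη : P.ε < P.η)
    (hρ : 0 < P.ρ) (hρ1 : P.ρ < 1) : (0 : ℝ) < P.halfShots := by
  have h := mul_sq_halfShots_ge hα hε hεη
  have h1 : 0 < Real.log (4 / P.ρ) := Real.log_pos (by rw [lt_div_iff₀ hρ]; linarith)
  have h2 : 0 ≤ Real.log (passBound P) := Real.log_natCast_nonneg _
  have h3 : 0 ≤ Real.log ((P.K : ℝ) + 1) := Real.log_nonneg (by simp)
  by_contra! hcon
  nlinarith [sq_nonneg P.α]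

/-- It suffices that real and imaginary parts are each accurate to `α / √2`. One of these `2 (K +
1)` averages fails with probability at most `2 exp (-n α ^ 2 / 4)`, where `n` is `halfShots`, and
`n` makes this at most `ρ / (2 (K + 1) passBound)`. -/
theorem toOuterMeasure_not_isAccurate_le (Q : QuantumInput V) {P : Params} (M : ℝ) (hα : 0 < P.α)
    (hε : 0 < P.ε) (hεη : P.ε < P.η) (hρ : 0 < P.ρ) (hρ1 : P.ρ < 1) :
    (piPMF fun c : Circuit P => Q.measure (Circuit.runtime M c) c.2.1).toOuterMeasure
      {o | ¬ IsAccurate Q P M o} ≤ ENNReal.ofReal (P.ρ / passBound P) := by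
  have hn := halfShots_pos hα hε hεη hρ hρ1
  set t := P.α / √2 with ht
  have ht0 : 0 < t := by positivity
  have ht2 : t ^ 2 = P.α ^ 2 / 2 := by rw [ht, div_pow, Real.sq_sqrt (by norm_num)]
  set mean : Fin (P.K + 1) × Bool → ℝ := fun i =>
    if i.2 then (inner ℂ Q.psi (Q.evolution (M * (i.1 : ℕ)) Q.psi)).im
      else (inner ℂ Q.psi (Q.evolution (M * (i.1 : ℕ)) Q.psi)).re with hmean
  set bad : Fin (P.K + 1) × Bool → Set (Circuit P → Fin 2) := fun i =>
    {o | t * Fintype.card (Fin P.halfShots) <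
      |∑ j, (if o (i.1, i.2, j) = 0 then (1 : ℝ) else -1) -
        Fintype.card (Fin P.halfShots) * mean i|} with hbad
  have hsub : {o | ¬ IsAccurate Q P M o} ⊆ ⋃ i ∈ (Finset.univ : Finset (Fin (P.K + 1) × Bool)),
      bad i := by
    intro o ho
    by_contra hcon
    simp only [Set.mem_iUnion, Finset.mem_univ, exists_true_left, not_exists] at hcon
    refine ho fun k => ?_
    have hav : ∀ im, |average P o k im - mean (k, im)| ≤ t := fun im => by
      have h := hcon (k, im)
      simp only [hbad, Set.mem_ofPred_eq, not_lt, Fintype.card_fin] at h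
      have e : average P o k im - mean (k, im) =
        (∑ j, (if o (k, im, j) = 0 then (1 : ℝ) else -1) - P.halfShots * mean (k, im)) /
          P.halfShots := by
        rw [average]; field_simp
      rw [e, abs_div, abs_of_pos hn, div_le_iff₀ hn]
      exact h
    have hre := sq_le_sq' (by linarith [(abs_le.mp (hav false)).1]) (abs_le.mp (hav false)).2
    have him := sq_le_sq' (by linarith [(abs_le.mp (hav true)).1]) (abs_le.mp (hav true)).2
    rw [ht2] at hre him
    simp only [hmean, Bool.false_eq_true, if_false, if_true] at hre him
    refine abs_le_of_sq_le_sq' ?_ hα.le |>.2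
    rw [Complex.sq_norm, Complex.normSq_apply]
    simp only [Complex.sub_re, Complex.add_re, Complex.ofReal_re, Complex.mul_re, Complex.I_re,
      mul_zero, Complex.ofReal_im, Complex.I_im, mul_one, add_zero, Complex.sub_im,
      Complex.add_im, Complex.mul_im, zero_add, sub_self]
    nlinarith
  have hexp : Real.exp (-(P.halfShots * t ^ 2 / 2)) ≤
      P.ρ / (4 * (P.K + 1) * passBound P) := by
    have hN : (0 : ℝ) < passBound P := by unfold passBound; positivity
    have h := mul_sq_halfShots_ge hα hε hεη
    rw [← Real.log_mul (by positivity) (by positivity),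
      ← Real.log_mul (by positivity) (by positivity)] at h
    rw [ht2, show (P.ρ / (4 * (P.K + 1) * passBound P) : ℝ) =
      (4 / P.ρ * passBound P * (P.K + 1))⁻¹ by field_simp, ← Real.exp_log (x := _⁻¹) (by positivity),
      Real.log_inv]
    apply Real.exp_le_exp.mpr
    linarith
  calc _ ≤ ∑ i ∈ (Finset.univ : Finset (Fin (P.K + 1) × Bool)),
        (piPMF fun c : Circuit P => Q.measure (Circuit.runtime M c) c.2.1).toOuterMeasure (bad i) :=
        (MeasureTheory.measure_mono hsub).trans (MeasureTheory.measure_biUnion_finset_le _ _)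
    _ ≤ ∑ i ∈ (Finset.univ : Finset (Fin (P.K + 1) × Bool)),
        ENNReal.ofReal (2 * (P.ρ / (4 * (P.K + 1) * passBound P))) := by
      refine Finset.sum_le_sum fun i _ => ?_
      refine (piPMF_hoeffding (fun c : Circuit P => Q.measure (Circuit.runtime M c) c.2.1)
        (fun j : Fin P.halfShots => (i.1, i.2, j)) (fun a b h => by simpa using h)
        (fun j => Q.measure_sub _ _) ht0.le).trans ?_
      rw [Fintype.card_fin]
      apply ENNReal.ofReal_le_ofReal
      linarith
    _ = ENNReal.ofReal (P.ρ / passBound P) := by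
      rw [Finset.sum_const, nsmul_eq_mul, ← ENNReal.ofReal_natCast,
        ← ENNReal.ofReal_mul (by positivity)]
      congr 1
      rw [Finset.card_univ, Fintype.card_prod, Fintype.card_fin, Fintype.card_bool]
      push_cast
      have hN : (0 : ℝ) < passBound P := by unfold passBound; positivity
      field_simp
      ring

variable [FiniteDimensional ℂ V] {Q : QuantumInput V} {S : ℕ} {lam : Fin S → ℝ} {P : Params}

/-- If the signal is accurate, the amplified eigenvalues lie in the filled level set, and this set
is close to their integer translates. -/
theorem IsAccurate.fillGaps_levelSet {M : ℝ} {o : Circuit P → Fin 2} (h : IsAccurate Q P M o)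
    (hQ : HasDominantEigenvalues Q S lam P.β P.ω) (hD : 0 < P.β - P.ω) (hD1 : P.β - P.ω ≤ 1)
    (hK : 24 * tau P.β P.ω ≤ P.K) (hα0 : 0 ≤ P.α) (hα : P.α < (P.β - P.ω) / 3) :
    (∀ s, M * lam s ∈ fillGaps P (levelSet P (signal P o))) ∧
    ∀ x ∈ fillGaps P (levelSet P (signal P o)), ∃ s, ∃ q : ℤ,
      |x - (M * lam s + q)| ≤ 3 / 2 * (tau P.β P.ω / P.K) := by
  classical
  obtain ⟨n, wt, μ, hwt, hwt1, hβ, hμ, hω, hform⟩ := hQ.exists_weights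
  have hτ := one_div_four_le_tau hD hD1
  have hK0 := cast_K_pos hD hD1 hK
  have hy : ∀ k ∈ Finset.Icc (-(P.K : ℤ)) P.K, ‖signal P o k -
      ∑ j, (wt j : ℂ) * Complex.exp (-(2 * Real.pi * Complex.I * k * (M * μ j : ℝ)))‖ ≤ P.α := by
    intro k hk
    rw [Finset.mem_Icc] at hk
    have hi : ((Fin.ofNat (P.K + 1) k.natAbs : Fin (P.K + 1)) : ℕ) = k.natAbs := by
      rw [Fin.val_ofNat, Nat.mod_eq_of_lt (by omega)]
    have hacc := h (Fin.ofNat (P.K + 1) k.natAbs)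
    rw [hform, hi] at hacc
    simp only [signal]
    split_ifs with h0
    · convert hacc using 6
      have : ((k.natAbs : ℕ) : ℂ) = (k : ℂ) := by
        rw [Nat.cast_natAbs, abs_of_nonneg h0]
      push_cast
      rw [this]
      ring
    · rw [← RCLike.norm_conj, map_sub, map_sum]
      refine (congrArg norm (congrArg₂ (· - ·) (Complex.conj_conj _)
        (Finset.sum_congr rfl fun j _ => ?_))).trans_le hacc
      rw [map_mul, Complex.conj_ofReal, ← Complex.exp_conj]
      have : ((k.natAbs : ℕ) : ℂ) = -(k : ℂ) := by
        rw [Nat.cast_natAbs, abs_of_neg (by omega)]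
        push_cast
        ring
      simp only [map_neg, map_mul, Complex.conj_ofReal, Complex.conj_I, map_ofNat, map_intCast]
      push_cast
      rw [this]
      congr 2
      ring
  constructor
  · intro s
    refine subset_fillGaps (by positivity) _ ?_
    have := mem_levelSet_of_le_weight hD hD1 hK hwt hwt1 hy hα0 hα (hβ s) 0
    simpa [hμ] using this
  · refine fun x hx => exists_of_mem_fillGaps (fun z hz => ?_) hx
    obtain ⟨j, hj, q, hq⟩ := exists_of_mem_levelSet hD hD1 hK hwt hwt1 hy hα0 hα
      (dom := fun j => j.isLeft = true) (by
        rw [Finset.sum_filter, Fintype.sum_sum_type]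
        simpa using hω) hz
    obtain ⟨s, rfl⟩ := Sum.isLeft_iff.mp hj
    exact ⟨s, q, by simpa [hμ] using hq⟩

end Pass

/-! ## The loop -/

/-- The invariants of the loop that hold for all measurement outcomes. -/
structure Config.Invariant (P : Params) (n : ℕ) (s : Config) : Prop where
  passes_le : s.passes ≤ n
  passes_eq : s.Continues P → s.passes = n
  eq_init : s.passes = 0 → s = Config.init
  pow_le : (2 : ℝ) ^ s.passes ≤ 2 * s.M
  one_le : 1 ≤ s.M
  le_div : s.M * P.ε ≤ 4 * P.η
  tmax_le : s.tmax ≤ s.M * P.K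
  ttotal_le : s.ttotal ≤ 2 * s.M * ((P.K : ℝ) * (P.K + 1) * P.halfShots)

theorem sum_runtime (P : Params) (M : ℝ) :
    ∑ c : Circuit P, Circuit.runtime M c = M * ((P.K : ℝ) * (P.K + 1) * P.halfShots) := by
  have h := Finset.sum_range_id_mul_two (P.K + 1)
  rw [← Fin.sum_univ_eq_sum_range (fun i => i), Nat.add_sub_cancel] at h
  have h2 : (∑ k : Fin (P.K + 1), ((k : ℕ) : ℝ)) * 2 = ((P.K : ℝ) + 1) * P.K := by
    exact_mod_cast h
  have h3 : ∑ c : Circuit P, Circuit.runtime M c =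
      M * ((∑ k : Fin (P.K + 1), ((k : ℕ) : ℝ)) * 2 * P.halfShots) := by
    simp only [Fintype.sum_prod_type, Circuit.runtime, Finset.sum_const, Finset.card_univ,
      Fintype.card_prod, Fintype.card_fin, Fintype.card_bool, nsmul_eq_mul, ← Finset.mul_sum]
    push_cast
    ring
  rw [h3, h2]
  ring

theorem Config.invariant_init {P : Params} (hη : P.ε ≤ 4 * P.η) :
    Config.Invariant P 0 Config.init where
  passes_le := le_rfl
  passes_eq _ := rfl
  eq_init _ := rfl
  pow_le := by norm_num [Config.init]
  one_le := le_rfl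
  le_div := by simpa [Config.init] using hη
  tmax_le := by simp [Config.init]
  ttotal_le := by simp only [Config.init]; positivity

/-! ### One pass with given measurement outcomes. -/

section Deterministic

variable {P : Params} {next : Config → ℝ} {n : ℕ} {s : Config}

theorem Config.nextM_of_init (h : s = Config.init) : s.nextM next = 1 := by
  subst h
  simp [Config.nextM, Config.init]

/-- A pass is entered only if `M ε < η`, and `M` grows at most fourfold, which gives `M ε ≤ 4 η`. A
factor `m ≥ 2` makes an old cost bounded by `2 M` plus a new cost `M m` at most `2 M m`, in units of
the cost at `M = 1`. The first pass, which keeps `M = 1`, is separate and causes the slack `2` in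
`pow_le`. -/
theorem Config.Invariant.update (hs : s.Invariant P n) (hc : s.Continues P) (hε : 0 < P.ε)
    (hnext : next s ∈ Set.Icc (2 : ℝ) 4) (o : Circuit P → Fin 2) :
    (s.update P (s.nextM next) o).Invariant P (n + 1) := by
  have hn := hs.passes_eq hc
  have hM := hs.one_le
  have hlt : s.M * P.ε < P.η := by
    have h : P.ε < P.η / s.M := hc
    rwa [lt_div_iff₀ (by linarith), mul_comm] at h
  have hW : 0 ≤ (P.K : ℝ) * (P.K + 1) * P.halfShots := by positivity
  have hη : 0 < P.η := lt_of_le_of_lt (by positivity) hlt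
  have hM' : s.M ≤ s.nextM next ∧ s.nextM next ≤ 4 * s.M ∧
      (2 : ℝ) ^ (s.passes + 1) ≤ 2 * s.nextM next ∧
      s.ttotal + s.nextM next * ((P.K : ℝ) * (P.K + 1) * P.halfShots) ≤
        2 * s.nextM next * ((P.K : ℝ) * (P.K + 1) * P.halfShots) := by
    by_cases h0 : s.passes = 0
    · have hi := hs.eq_init h0
      rw [Config.nextM_of_init hi, hi]
      simp only [Config.init]
      refine ⟨le_rfl, by norm_num, by norm_num, by linarith⟩
    · have ht := hs.ttotal_le
      have hp := hs.pow_le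
      simp only [Config.nextM, if_neg h0]
      refine ⟨by nlinarith [hnext.1], by nlinarith [hnext.2], ?_, ?_⟩
      · rw [pow_succ]
        nlinarith [hnext.1]
      · have : 2 * s.M * ((P.K : ℝ) * (P.K + 1) * P.halfShots) ≤
            s.M * next s * ((P.K : ℝ) * (P.K + 1) * P.halfShots) := by
          apply mul_le_mul_of_nonneg_right _ hW
          nlinarith [hnext.1]
        linarith
  obtain ⟨h1, h2, h3, h4⟩ := hM'
  have hK : (0 : ℝ) ≤ P.K := Nat.cast_nonneg _
  exact
    { passes_le := by simp [Config.update, hn]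
      passes_eq := fun _ => by simp [Config.update, hn]
      eq_init := fun h => by simp [Config.update] at h
      pow_le := h3
      one_le := hM.trans h1
      le_div := by
        change s.nextM next * P.ε ≤ _
        nlinarith
      tmax_le := by
        refine Finset.fold_max_le _ |>.mpr ⟨hs.tmax_le.trans ?_, fun c _ => ?_⟩
        · exact mul_le_mul_of_nonneg_right h1 hK
        · refine mul_le_mul_of_nonneg_left ?_ (by change 0 ≤ s.nextM next; linarith)
          exact_mod_cast Nat.lt_succ_iff.mp c.1.2
      ttotal_le := by
        simp only [Config.update, sum_runtime]
        exact h4 }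

/-- If the loop continued, then `2 ^ n ≤ 2 M < 2 η / ε`. The `+ 1` in `passBound` absorbs this
factor `2`. -/
theorem Config.Invariant.not_continues (hs : s.Invariant P n) (hε : 0 < P.ε) (hεη : P.ε < P.η)
    (hn : passBound P ≤ n) : ¬ s.Continues P := by
  intro hc
  have hM := hs.one_le
  have h : P.ε < P.η / s.M := hc
  rw [lt_div_iff₀ (by linarith)] at h
  have hp := hs.pow_le
  rw [hs.passes_eq hc] at hp
  have h1 : P.η / P.ε ≤ (2 : ℝ) ^ ⌈Real.logb 2 (P.η / P.ε)⌉₊ := by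
    rw [← Real.rpow_natCast, ← Real.logb_le_iff_le_rpow (by norm_num)
      (div_pos (hε.trans hεη) hε)]
    exact Nat.le_ceil _
  have h2 : (2 : ℝ) ^ (⌈Real.logb 2 (P.η / P.ε)⌉₊ + 1) ≤ 2 ^ n :=
    pow_le_pow_right₀ (by norm_num) hn
  rw [pow_succ] at h2
  rw [div_le_iff₀ hε] at h1
  nlinarith

/-- The estimate contains the dominant eigenvalues and, after the first pass, is close to them. -/
def Config.Correct (P : Params) (Λ : Set ℝ) (s : Config) : Prop :=
  Λ ⊆ s.E ∧ (s.passes ≠ 0 → s.E ⊆ nbhd Λ (P.η / (2 * s.M)))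

theorem Config.Correct.update {V : Type*} [NormedAddCommGroup V] [InnerProductSpace ℂ V]
    [CompleteSpace V] [FiniteDimensional ℂ V] {Q : QuantumInput V} {S : ℕ} {lam : Fin S → ℝ}
    (hS : 1 ≤ S) (hη : P.η = etaChoice S) (hlam : ∀ s, lam s ∈ Set.Icc (0 : ℝ) (9 / 10))
    (hQ : HasDominantEigenvalues Q S lam P.β P.ω) (hD : 0 < P.β - P.ω) (hD1 : P.β - P.ω ≤ 1)
    (hK : 3 * (etaChoice S)⁻¹ * tau P.β P.ω ≤ P.K) (hα0 : 0 ≤ P.α)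
    (hα : P.α < (P.β - P.ω) / 3) (hnext : IsFactorRule (etaChoice S) next)
    (hs : s.Invariant P n) (hcorr : s.Correct P (Set.range lam)) {o : Circuit P → Fin 2}
    (ho : IsAccurate Q P (s.nextM next) o) :
    (s.update P (s.nextM next) o).Correct P (Set.range lam) := by
  have hη0 := etaChoice_pos hS
  have hη1 := etaChoice_le hS
  have hτ := one_div_four_le_tau hD hD1
  have hM := hs.one_le
  have hK' : 24 * tau P.β P.ω ≤ P.K := by
    refine le_trans ?_ hK
    have : 8 ≤ (etaChoice S)⁻¹ := by
      rw [le_inv_comm₀ (by norm_num) hη0]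
      linarith
    nlinarith
  have hK0 := cast_K_pos hD hD1 hK'
  -- The purpose of `K ≥ 3 τ / η`: after division by `M`, the filled level set is accurate to `η /
  -- (2 M)`.
  have hτK : 3 / 2 * (tau P.β P.ω / P.K) ≤ etaChoice S / 2 := by
    have : 3 * tau P.β P.ω ≤ etaChoice S * P.K := by
      calc 3 * tau P.β P.ω = etaChoice S * (3 * (etaChoice S)⁻¹ * tau P.β P.ω) := by
            field_simp
        _ ≤ _ := by gcongr
    rw [← mul_div_assoc, div_le_iff₀ hK0]
    linarith
  obtain ⟨hmem, hnear⟩ := ho.fillGaps_levelSet hQ hD hD1 hK' hα0 hα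
  set Y := fillGaps P (levelSet P (signal P o)) with hY
  have hM0 : 0 < s.nextM next := by
    unfold Config.nextM
    have := (hnext s).1.1
    split_ifs <;> nlinarith
  have hnear' : ∀ z, s.nextM next * z ∈ Y → ∃ i, ∃ q : ℤ,
      |z - (lam i + q / s.nextM next)| ≤ etaChoice S / (2 * s.nextM next) := by
    intro z hz
    obtain ⟨i, q, h⟩ := hnear _ hz
    refine ⟨i, q, ?_⟩
    have e : s.nextM next * z - (s.nextM next * lam i + q) =
        s.nextM next * (z - (lam i + q / s.nextM next)) := by
      field_simp
    rw [e, abs_mul, abs_of_pos hM0] at h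
    rw [← div_div, le_div_iff₀ hM0]
    linarith
  refine ⟨?_, fun _ => ?_⟩
  · rintro _ ⟨i, rfl⟩
    exact mem_updateEstimate (hcorr.1 ⟨i, rfl⟩) (hmem i)
  · change updateEstimate (s.nextM next) Y s.E ⊆
      nbhd (Set.range lam) (P.η / (2 * s.nextM next))
    rw [hη]
    by_cases h0 : s.passes = 0
    · have hi := hs.eq_init h0
      rw [Config.nextM_of_init hi] at hnear' ⊢
      rw [hi]
      exact updateEstimate_subset_of_Icc hS hlam hnear'
    · have hE := hcorr.2 h0
      rw [hη] at hE
      simp only [Config.nextM, if_neg h0] at hnear' ⊢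
      exact updateEstimate_subset_of_separates (by linarith) (by linarith [(hnext s).1.1]) hη0.le
        hcorr.1 ((hnext s).2 (exists_separates hS lam (by linarith) hE)) hnear'

end Deterministic

/-! ### The law of the whole run. -/

section Run

variable {V : Type*} [NormedAddCommGroup V] [InnerProductSpace ℂ V] [CompleteSpace V]
  {Q : QuantumInput V} {P : Params} {next : Config → ℝ}

theorem invariant_of_mem_support_run (hε : 0 < P.ε) (hεη : P.ε < P.η)
    (hnext : ∀ s, next s ∈ Set.Icc (2 : ℝ) 4) (n : ℕ) {s : Config}
    (hs : s ∈ (run Q P next n).support) : s.Invariant P n := by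
  induction n generalizing s with
  | zero =>
    rw [run, PMF.mem_support_pure_iff] at hs
    rw [hs]
    exact Config.invariant_init (by linarith)
  | succ n ih =>
    rw [run, PMF.mem_support_bind_iff] at hs
    obtain ⟨s', hs', h⟩ := hs
    have hi := ih hs'
    rw [loopStep] at h
    split_ifs at h with hc
    · rw [PMF.mem_support_map_iff] at h
      obtain ⟨o, -, rfl⟩ := h
      exact hi.update hc hε (hnext _) o
    · rw [PMF.mem_support_pure_iff] at h
      subst h
      exact { hi with passes_le := hi.passes_le.trans (Nat.le_succ n), passes_eq := fun h => absurd h hc }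

/-- A correct configuration becomes incorrect only through an inaccurate signal, and the bound for
one pass holds conditionally on any configuration, so the adaptive choice of `M` is harmless. From
iteration `passBound` on no pass is executed and no probability is lost, hence the minimum. -/
theorem toOuterMeasure_not_correct_le [FiniteDimensional ℂ V] {S : ℕ} {lam : Fin S → ℝ}
    (hS : 1 ≤ S) (hη : P.η = etaChoice S) (hlam : ∀ s, lam s ∈ Set.Icc (0 : ℝ) (9 / 10))
    (hQ : HasDominantEigenvalues Q S lam P.β P.ω) (hD : 0 < P.β - P.ω) (hD1 : P.β - P.ω ≤ 1)
    (hK : 3 * (etaChoice S)⁻¹ * tau P.β P.ω ≤ P.K) (hα0 : 0 < P.α)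
    (hα : P.α < (P.β - P.ω) / 3) (hnext : IsFactorRule (etaChoice S) next)
    (hε : 0 < P.ε) (hεη : P.ε < P.η) (hρ : 0 < P.ρ) (hρ1 : P.ρ < 1) (n : ℕ) :
    (run Q P next n).toOuterMeasure {s | ¬ s.Correct P (Set.range lam)} ≤
      (min n (passBound P) : ℕ) * ENNReal.ofReal (P.ρ / passBound P) := by
  induction n with
  | zero =>
    rw [run, PMF.toOuterMeasure_pure_apply, if_neg]
    · exact zero_le
    · simp only [Set.mem_ofPred_eq, not_not]
      refine ⟨?_, fun h => absurd rfl h⟩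
      rintro _ ⟨s, rfl⟩
      exact hlam s
  | succ n ih =>
    set bad : Set Config := {s | ¬ s.Correct P (Set.range lam)} with hbad
    set δ := ENNReal.ofReal (P.ρ / passBound P) with hδ
    set δ' : ℝ≥0∞ := if n < passBound P then δ else 0 with hδ'
    have key : ∀ s, run Q P next n s * (loopStep Q P next s).toOuterMeasure bad ≤
        bad.indicator (run Q P next n) s + run Q P next n s * δ' := by
      intro s
      by_cases hs : s ∈ (run Q P next n).support
      swap
      · rw [PMF.mem_support_iff, not_not] at hs
        rw [hs, zero_mul]
        exact zero_le
      have hi := invariant_of_mem_support_run hε hεη (fun s => (hnext s).1) n hs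
      by_cases hb : s ∈ bad
      · rw [Set.indicator_of_mem hb]
        refine le_trans ?_ le_self_add
        calc _ ≤ run Q P next n s * 1 := by
              gcongr
              exact ((loopStep Q P next s).toOuterMeasure.mono (Set.subset_univ _)).trans_eq
                ((PMF.toOuterMeasure_apply_eq_one_iff _ _).mpr (Set.subset_univ _))
          _ = _ := mul_one _
      · rw [Set.indicator_of_notMem hb, zero_add]
        gcongr
        rw [loopStep]
        split_ifs with hc
        · have hn : n < passBound P := by
            by_contra! hcon
            exact hi.not_continues hε hεη hcon hc
          rw [hδ', if_pos hn, PMF.toOuterMeasure_map_apply]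
          refine ((PMF.toOuterMeasure _).mono ?_).trans
            (toOuterMeasure_not_isAccurate_le Q (s.nextM next) hα0 hε hεη hρ hρ1)
          intro o ho hacc
          exact ho (Config.Correct.update hS hη hlam hQ hD hD1 hK hα0.le hα hnext hi
            (not_not.mp hb) hacc)
        · rw [PMF.toOuterMeasure_pure_apply, if_neg hb]
          exact zero_le
    rw [run, PMF.toOuterMeasure_bind_apply]
    calc _ ≤ ∑' s, (bad.indicator (run Q P next n) s + run Q P next n s * δ') :=
          ENNReal.tsum_le_tsum key
      _ = (run Q P next n).toOuterMeasure bad + δ' := by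
          rw [ENNReal.tsum_add, ENNReal.tsum_mul_right, PMF.tsum_coe, one_mul,
            PMF.toOuterMeasure_apply]
      _ ≤ (min n (passBound P) : ℕ) * δ + δ' := by gcongr
      _ = _ := by
          rw [hδ']
          split_ifs with h
          · rw [min_eq_left h.le, min_eq_left (by omega)]
            push_cast
            ring
          · rw [min_eq_right (by omega), min_eq_right (by omega), add_zero]

theorem ofReal_one_sub_le_toOuterMeasure {α : Type*} (p : PMF α) {good target : Set α} {ρ : ℝ}
    (hρ : 0 ≤ ρ) (h : p.toOuterMeasure {x | x ∉ good} ≤ ENNReal.ofReal ρ)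
    (hsub : good ∩ p.support ⊆ target) : ENNReal.ofReal (1 - ρ) ≤ p.toOuterMeasure target := by
  have h1 : p.toOuterMeasure Set.univ = 1 :=
    (PMF.toOuterMeasure_apply_eq_one_iff _ _).mpr (Set.subset_univ _)
  have h2 : (Set.univ : Set α) ⊆ good ∪ {x | x ∉ good} := fun x _ => Classical.em _
  have h3 := (MeasureTheory.measure_mono (μ := p.toOuterMeasure) h2).trans (MeasureTheory.measure_union_le _ _)
  rw [h1] at h3
  rw [ENNReal.ofReal_sub _ hρ, ENNReal.ofReal_one, tsub_le_iff_right]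
  exact h3.trans (add_le_add (PMF.toOuterMeasure_mono p hsub) h)

end Run

/-! ## Runtime bounds -/

/-- The model forces this: `β` is at most a single weight, hence at most `1`, and `ω` bounds a
nonnegative sum. -/
theorem HasDominantEigenvalues.sub_le_one {V : Type*} [NormedAddCommGroup V]
    [InnerProductSpace ℂ V] [CompleteSpace V] [FiniteDimensional ℂ V] {Q : QuantumInput V} {S : ℕ}
    {lam : Fin S → ℝ} {β ω : ℝ} (h : HasDominantEigenvalues Q S lam β ω) (hS : 1 ≤ S) :
    β - ω ≤ 1 := by
  obtain ⟨n, wt, μ, hwt, hwt1, hβ, -, hω, -⟩ := h.exists_weights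
  have h1 := Finset.single_le_sum (f := wt) (fun j _ => hwt j) (Finset.mem_univ (Sum.inl ⟨0, hS⟩))
  have h2 := Finset.sum_nonneg fun j (_ : j ∈ Finset.univ) => hwt (Sum.inr j)
  linarith [hβ ⟨0, hS⟩]

theorem tau_le {β ω : ℝ} (hD : 0 < β - ω) (hD1 : β - ω ≤ 1) :
    tau β ω ≤ 1 + Real.log (1 / (β - ω)) / 3 := by
  have hℓ : 0 ≤ Real.log (1 / (β - ω)) := Real.log_nonneg ((one_le_div hD).mpr hD1)
  have h12 : Real.log 12 ≤ 3 := by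
    rw [Real.log_le_iff_le_exp (by norm_num), show (3 : ℝ) = 1 + 1 + 1 by norm_num, Real.exp_add,
      Real.exp_add]
    have := Real.exp_one_gt_d9
    nlinarith [mul_pos (Real.exp_pos 1) (Real.exp_pos 1)]
  have e : Real.log (12 / (β - ω)) = Real.log 12 + Real.log (1 / (β - ω)) := by
    rw [← Real.log_mul (by norm_num) (by positivity), mul_one_div]
  rw [tau, e, div_mul_eq_mul_div, one_mul, div_le_iff₀ Real.pi_pos]
  nlinarith [Real.pi_gt_three]

section Runtime

variable {S : ℕ} {β ω ε ρ α : ℝ}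

/-- The dependence on `S` cancels, as `η K` is `3 τ` up to rounding. The largest runtime `M K ≤ 4 η
K / ε` is therefore free of `S`. -/
theorem etaChoice_mul_K_le (hS : 1 ≤ S) (hD : 0 < β - ω) (hD1 : β - ω ≤ 1) :
    etaChoice S * (gaplessParams S β ω ε ρ α).K ≤ 13 / 4 * (1 + Real.log (1 / (β - ω))) := by
  have hη := etaChoice_pos hS
  have hη1 := etaChoice_le hS
  have hτ := one_div_four_le_tau hD hD1
  have hτ2 := tau_le hD hD1
  have hK : ((gaplessParams S β ω ε ρ α).K : ℝ) ≤ 3 * (etaChoice S)⁻¹ * tau β ω + 1 :=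
    (Nat.ceil_lt_add_one (by positivity)).le
  have hℓ : 0 ≤ Real.log (1 / (β - ω)) := Real.log_nonneg ((one_le_div hD).mpr hD1)
  calc _ ≤ etaChoice S * (3 * (etaChoice S)⁻¹ * tau β ω + 1) := by gcongr
    _ = 3 * tau β ω + etaChoice S := by field_simp
    _ ≤ _ := by linarith

theorem tmax_le_of_invariant (hS : 1 ≤ S) (hD : 0 < β - ω) (hD1 : β - ω ≤ 1) (hε : 0 < ε) {n : ℕ}
    {s : Config} (hs : s.Invariant (gaplessParams S β ω ε ρ α) n) :
    s.tmax ≤ 13 * (1 + Real.log (1 / (β - ω))) * ε⁻¹ := by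
  have h1 : s.M * ε ≤ 4 * etaChoice S := hs.le_div
  have h2 := hs.tmax_le
  have h3 := etaChoice_mul_K_le (ε := ε) (ρ := ρ) (α := α) hS hD hD1
  rw [← div_eq_mul_inv, le_div_iff₀ hε]
  calc s.tmax * ε ≤ s.M * (gaplessParams S β ω ε ρ α).K * ε := by gcongr
    _ = s.M * ε * (gaplessParams S β ω ε ρ α).K := by ring
    _ ≤ 4 * etaChoice S * (gaplessParams S β ω ε ρ α).K := by gcongr
    _ ≤ _ := by linarith

theorem halfShots_le (hS : 1 ≤ S) (hD : 0 < β - ω) (hD1 : β - ω ≤ 1) (hε : 0 < ε)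
    (hεη : ε < etaChoice S) (hρ : 0 < ρ) (hρ1 : ρ < 1) {a : ℝ} (ha : 0 < a)
    (hα : a * (β - ω) ≤ α) :
    ((gaplessParams S β ω ε ρ α).halfShots : ℝ) ≤
      (52 / a ^ 2 + 1) * ((β - ω) ^ 2)⁻¹ * logFactor S β ω ε ρ := by
  have hη := etaChoice_pos hS
  have hη1 := etaChoice_le hS
  have hS1 : (1 : ℝ) ≤ S := by exact_mod_cast hS
  set F := logFactor S β ω ε ρ with hF
  have l1 : 0 ≤ Real.log S := Real.log_nonneg hS1
  have l2 : 0 ≤ Real.log (1 / (β - ω)) := Real.log_nonneg ((one_le_div hD).mpr hD1)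
  have l3 : 0 ≤ Real.log (1 / ε) := Real.log_nonneg ((one_le_div hε).mpr (by linarith))
  have l4 : 0 ≤ Real.log (1 / ρ) := Real.log_nonneg ((one_le_div hρ).mpr hρ1.le)
  have hFe : F = 1 + Real.log S + Real.log (1 / (β - ω)) + Real.log (1 / ε) + Real.log (1 / ρ) := rfl
  have hlog2 := Real.log_two_lt_d9
  have hlog2' := Real.log_two_gt_d9
  set P := gaplessParams S β ω ε ρ α with hP
  have t1 : Real.log (4 / ρ) ≤ 2 + Real.log (1 / ρ) := by
    rw [show 4 / ρ = 2 ^ 2 * (1 / ρ) by ring, Real.log_mul (by norm_num) (by positivity),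
      Real.log_pow]
    push_cast
    linarith
  have t2 : Real.log ((⌈Real.logb 2 (etaChoice S / ε)⌉ : ℝ) + 1) ≤ 1 + 2 * Real.log (1 / ε) := by
    have h0 : 0 ≤ Real.logb 2 (etaChoice S / ε) :=
      Real.logb_nonneg (by norm_num) ((one_le_div hε).mpr hεη.le)
    have h1 : Real.logb 2 (etaChoice S / ε) ≤ 2 * Real.log (1 / ε) := by
      rw [Real.logb, div_le_iff₀ (by linarith)]
      have : Real.log (etaChoice S / ε) ≤ Real.log (1 / ε) :=
        Real.log_le_log (by positivity) (by gcongr; linarith)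
      nlinarith
    have h2 := (Int.ceil_lt_add_one (Real.logb 2 (etaChoice S / ε))).le
    have h3 : (0 : ℝ) ≤ ⌈Real.logb 2 (etaChoice S / ε)⌉ := by exact_mod_cast Int.ceil_nonneg h0
    have h4 := Real.log_le_sub_one_of_pos
      (by linarith : 0 < (⌈Real.logb 2 (etaChoice S / ε)⌉ : ℝ) + 1)
    linarith
  have t3 : Real.log ((P.K : ℝ) + 1) ≤ 5 + F + 2 * Real.log S := by
    have hK := etaChoice_mul_K_le (ε := ε) (ρ := ρ) (α := α) hS hD hD1
    have h1 : (P.K : ℝ) + 1 ≤ 2 ^ 7 * F * S ^ 2 := by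
      have h2 := etaChoice_mul hS
      have h3 : (P.K : ℝ) = (8 * S * (2 * S - 1)) * (etaChoice S * P.K) := by
        linear_combination (-(P.K : ℝ)) * h2
      have h4 : (P.K : ℝ) ≤ (16 * S ^ 2) * (13 / 4 * F) := by
        rw [h3]
        refine mul_le_mul (by nlinarith) (by linarith) (by positivity) (by positivity)
      have h5 : 1 ≤ F * (S : ℝ) ^ 2 := by nlinarith
      nlinarith
    have hF0 : 0 < F := by linarith
    calc _ ≤ Real.log (2 ^ 7 * F * S ^ 2) := Real.log_le_log (by positivity) h1
      _ = 7 * Real.log 2 + Real.log F + 2 * Real.log S := by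
        rw [Real.log_mul (by positivity) (by positivity),
          Real.log_mul (by positivity) (by positivity), Real.log_pow, Real.log_pow]
        push_cast
        ring
      _ ≤ _ := by linarith [Real.log_le_sub_one_of_pos hF0]
  have hL0 : 0 ≤ Real.log (4 / ρ) := Real.log_nonneg (by rw [le_div_iff₀ hρ]; linarith)
  set L := Real.log (4 / ρ) + Real.log ((⌈Real.logb 2 (etaChoice S / ε)⌉ : ℝ) + 1) +
    Real.log ((P.K : ℝ) + 1) with hL
  have hLF : L ≤ 13 * F := by linarith
  -- The maximum with `0` spares the sign of `L`: a natural-number ceiling vanishes on nonpositive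
  -- arguments.
  have hn : (P.halfShots : ℝ) ≤ max (4 / α ^ 2 * L) 0 + 1 := by
    rcases le_total 0 (4 / α ^ 2 * L) with h | h
    · rw [max_eq_left h]
      exact (Nat.ceil_lt_add_one h).le
    · have : P.halfShots = 0 := Nat.ceil_eq_zero.mpr h
      rw [this, max_eq_right h]
      norm_num
  have hα2 : 4 / α ^ 2 ≤ 4 / a ^ 2 * ((β - ω) ^ 2)⁻¹ := by
    rw [← div_eq_mul_inv, div_div, ← mul_pow]
    gcongr
  have hD2 : 1 ≤ ((β - ω) ^ 2)⁻¹ := by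
    rw [one_le_inv₀ (by positivity)]
    exact pow_le_one₀ hD.le hD1
  have hmax : max (4 / α ^ 2 * L) 0 ≤ 4 / a ^ 2 * ((β - ω) ^ 2)⁻¹ * (13 * F) := by
    have hF0 : 0 ≤ F := by linarith
    refine max_le ?_ (by positivity)
    calc _ ≤ 4 / α ^ 2 * (13 * F) := by gcongr
      _ ≤ _ := by gcongr
  calc _ ≤ max (4 / α ^ 2 * L) 0 + 1 := hn
    _ ≤ 4 / a ^ 2 * ((β - ω) ^ 2)⁻¹ * (13 * F) + ((β - ω) ^ 2)⁻¹ * F := by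
      have : 1 ≤ ((β - ω) ^ 2)⁻¹ * F := one_le_mul_of_one_le_of_one_le hD2 (by linarith)
      linarith
    _ = _ := by ring

/-- Two powers of the logarithmic factor come from `(η K) ^ 2`, the third from `halfShots`. The
factor `S ^ 2` is `1 / η`. -/
theorem ttotal_le_of_invariant (hS : 1 ≤ S) (hD : 0 < β - ω) (hD1 : β - ω ≤ 1) (hε : 0 < ε)
    (hεη : ε < etaChoice S) (hρ : 0 < ρ) (hρ1 : ρ < 1) {a : ℝ} (ha : 0 < a)
    (hα : a * (β - ω) ≤ α) {n : ℕ} {s : Config}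
    (hs : s.Invariant (gaplessParams S β ω ε ρ α) n) :
    s.ttotal ≤ 4096 * (52 / a ^ 2 + 1) * ((β - ω) ^ 2)⁻¹ * (S : ℝ) ^ 2 * ε⁻¹ *
      logFactor S β ω ε ρ ^ 3 := by
  have hη := etaChoice_pos hS
  have hη1 := etaChoice_le hS
  have hS1 : (1 : ℝ) ≤ S := by exact_mod_cast hS
  have hn := halfShots_le hS hD hD1 hε hεη hρ hρ1 ha hα
  have h1 : s.M * ε ≤ 4 * etaChoice S := hs.le_div
  have h2 := hs.ttotal_le
  have hK := etaChoice_mul_K_le (ε := ε) (ρ := ρ) (α := α) hS hD hD1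
  have l1 : 0 ≤ Real.log S := Real.log_nonneg hS1
  have l2 : 0 ≤ Real.log (1 / (β - ω)) := Real.log_nonneg ((one_le_div hD).mpr hD1)
  have l3 : 0 ≤ Real.log (1 / ε) := Real.log_nonneg ((one_le_div hε).mpr (by linarith))
  have l4 : 0 ≤ Real.log (1 / ρ) := Real.log_nonneg ((one_le_div hρ).mpr hρ1.le)
  have hFe : logFactor S β ω ε ρ =
    1 + Real.log S + Real.log (1 / (β - ω)) + Real.log (1 / ε) + Real.log (1 / ρ) := rfl
  set F := logFactor S β ω ε ρ with hF
  set P := gaplessParams S β ω ε ρ α with hP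
  have hKF : etaChoice S * P.K ≤ 4 * F := by linarith
  have hF0 : 0 ≤ F := by linarith
  have hKK : etaChoice S * ((P.K : ℝ) * (P.K + 1)) ≤ 512 * F ^ 2 * S ^ 2 := by
    have h3 : (P.K : ℝ) + 1 ≤ 2 * P.K := by
      have : (1 : ℝ) ≤ P.K := by
        have hτ := one_div_four_le_tau hD hD1
        have : 1 ≤ P.K := Nat.one_le_ceil_iff.mpr (by positivity)
        exact_mod_cast this
      linarith
    have h4 := etaChoice_mul hS
    calc etaChoice S * ((P.K : ℝ) * (P.K + 1)) ≤ etaChoice S * ((P.K : ℝ) * (2 * P.K)) := by gcongr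
      _ = 2 * (etaChoice S * P.K) ^ 2 * (8 * S * (2 * S - 1)) := by
        linear_combination (-2 * etaChoice S * (P.K : ℝ) ^ 2) * h4
      _ ≤ 2 * (4 * F) ^ 2 * (16 * S ^ 2) := by
        refine mul_le_mul (by gcongr) (by nlinarith) (by nlinarith) (by positivity)
      _ = _ := by ring
  rw [show 4096 * (52 / a ^ 2 + 1) * ((β - ω) ^ 2)⁻¹ * (S : ℝ) ^ 2 * ε⁻¹ * F ^ 3 =
    4096 * (52 / a ^ 2 + 1) * ((β - ω) ^ 2)⁻¹ * (S : ℝ) ^ 2 * F ^ 3 / ε by ring, le_div_iff₀ hε]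
  calc s.ttotal * ε ≤ 2 * s.M * ((P.K : ℝ) * (P.K + 1) * P.halfShots) * ε := by gcongr
    _ = 2 * (s.M * ε) * ((P.K : ℝ) * (P.K + 1) * P.halfShots) := by ring
    _ ≤ 2 * (4 * etaChoice S) * ((P.K : ℝ) * (P.K + 1) * P.halfShots) := by gcongr
    _ = 8 * (etaChoice S * ((P.K : ℝ) * (P.K + 1))) * P.halfShots := by ring
    _ ≤ 8 * (512 * F ^ 2 * S ^ 2) * ((52 / a ^ 2 + 1) * ((β - ω) ^ 2)⁻¹ * F) := by gcongr
    _ = _ := by ring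

end Runtime

end

end RMPE

/-! ### Assembly of correctness, termination and runtime. -/

theorem mainTheorem7 :
    ∃ C₁ : ℝ, ∃ p : ℕ, ∀ a : ℝ, 0 < a → ∃ C₂ : ℝ,
      ∀ (V : Type*) [NormedAddCommGroup V] [InnerProductSpace ℂ V] [CompleteSpace V]
        [FiniteDimensional ℂ V] (Q : RMPE.QuantumInput V) (S : ℕ) (lam : Fin S → ℝ)
        (β ω ε ρ α : ℝ) (next : RMPE.Config → ℝ),
        1 ≤ S →
        ω < β →
        RMPE.HasDominantEigenvalues Q S lam β ω →
        (∀ s, lam s ∈ Set.Icc (0 : ℝ) (9 / 10)) →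
        0 < ε → ε < RMPE.etaChoice S →
        0 < ρ → ρ < 1 →
        a * (β - ω) ≤ α → α < (β - ω) / 3 →
        RMPE.IsFactorRule (RMPE.etaChoice S) next →
        ∀ n : ℕ, ⌈Real.logb 2 (RMPE.etaChoice S / ε)⌉₊ + 1 ≤ n →
          -- the estimate is correct with probability at least `1 - ρ`
          ENNReal.ofReal (1 - ρ) ≤
            (RMPE.run Q (RMPE.gaplessParams S β ω ε ρ α) next n).toOuterMeasure
              {s | Set.range lam ⊆ s.E ∧ s.E ⊆ RMPE.nbhd (Set.range lam) ε} ∧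
          ∀ s ∈ (RMPE.run Q (RMPE.gaplessParams S β ω ε ρ α) next n).support,
            -- the loop has ended
            ¬ s.Continues (RMPE.gaplessParams S β ω ε ρ α) ∧
            -- maximum runtime
            s.tmax ≤ C₁ * (1 + Real.log (1 / (β - ω))) * ε⁻¹ ∧
            (β - ω ≤ 1 / 2 → s.tmax ≤ C₁ * Real.log (1 / (β - ω)) * ε⁻¹) ∧
            -- total runtime
            s.ttotal ≤ C₂ * ((β - ω) ^ 2)⁻¹ * (S : ℝ) ^ 2 * ε⁻¹ *
              RMPE.logFactor S β ω ε ρ ^ p := by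
  -- The invariants give the constant `13`. Since `13 (1 + ℓ) ≤ 40 ℓ` for `ℓ ≥ log 2`, the value
  -- `40` also serves the form without the summand `1`.
  refine ⟨40, 3, fun a ha => ⟨4096 * (52 / a ^ 2 + 1), ?_⟩⟩
  intro V _ _ _ _ Q S lam β ω ε ρ α next hS hD hQ hlam hε hεη hρ hρ1 haα hα hnext n hn
  have hD : 0 < β - ω := sub_pos.mpr hD
  have hD1 := hQ.sub_le_one hS
  have hα0 : 0 < α := lt_of_lt_of_le (by positivity) haα
  have hinv := fun s => RMPE.invariant_of_mem_support_run (Q := Q)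
    (P := RMPE.gaplessParams S β ω ε ρ α) hε hεη (fun s => (hnext s).1) n (s := s)
  have hend := fun s hs => (hinv s hs).not_continues hε hεη hn
  refine ⟨?_, fun s hs => ⟨hend s hs, ?_, fun hD2 => ?_, ?_⟩⟩
  · have hbad := RMPE.toOuterMeasure_not_correct_le (Q := Q)
      (P := RMPE.gaplessParams S β ω ε ρ α) hS rfl hlam hQ hD hD1 (Nat.le_ceil _) hα0 hα hnext
      hε hεη hρ hρ1 n
    refine RMPE.ofReal_one_sub_le_toOuterMeasure _ hρ.le (hbad.trans ?_) ?_
    · have hN : (0 : ℝ) < RMPE.passBound (RMPE.gaplessParams S β ω ε ρ α) := by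
        unfold RMPE.passBound
        positivity
      have hn' : RMPE.passBound (RMPE.gaplessParams S β ω ε ρ α) ≤ n := hn
      rw [min_eq_right hn', ← ENNReal.ofReal_natCast, ← ENNReal.ofReal_mul hN.le,
        mul_div_cancel₀ _ hN.ne']
      exact le_rfl
    · rintro s ⟨hcorr, hs⟩
      have hi := hinv s hs
      have hended := hend s hs
      -- Since `ε < η`, the loop cannot end before its first pass, so the output is `η / (2
      -- M)`-close to the eigenvalues, and the exit condition says `η / M ≤ ε`.
      have hpass : s.passes ≠ 0 := fun h0 => hended (by
        rw [hi.eq_init h0]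
        change ε < RMPE.etaChoice S / 1
        rwa [div_one])
      refine ⟨hcorr.1, (hcorr.2 hpass).trans (RMPE.nbhd_mono ?_)⟩
      have h1 : RMPE.etaChoice S / s.M ≤ ε := not_lt.mp hended
      have h2 := RMPE.etaChoice_pos hS
      have h3 := hi.one_le
      refine le_trans ?_ h1
      change RMPE.etaChoice S / (2 * s.M) ≤ _
      gcongr
      linarith
  · have h := RMPE.tmax_le_of_invariant hS hD hD1 hε (hinv s hs)
    have hl : 0 ≤ Real.log (1 / (β - ω)) := Real.log_nonneg ((one_le_div hD).mpr hD1)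
    refine h.trans ?_
    gcongr
    norm_num
  · have h := RMPE.tmax_le_of_invariant hS hD hD1 hε (hinv s hs)
    have hl : Real.log 2 ≤ Real.log (1 / (β - ω)) := by
      apply Real.log_le_log (by norm_num)
      rw [le_div_iff₀ hD]
      linarith
    have hl2 := Real.log_two_gt_d9
    exact h.trans (mul_le_mul_of_nonneg_right (by linarith) (by positivity))
  · exact RMPE.ttotal_le_of_invariant hS hD hD1 hε hεη hρ hρ1 ha haα (hinv s hs)
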